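/- Let $q>2$, $p\ge \frac{q}{q-1}$, $k\in(0,1)$ and $x_0\in\mathbb R$, and write $d(x)=|x-x_0|$. Let $V:\mathbb R\to\mathbb R$ be a potential, differentiable at Lebesgue-almost every point, of the form $$V(x)=d(x)^p+\alpha(x)\cos(x),$$ where $\alpha:\mathbb R\to\mathbb R$ satisfies $\alpha(x)=k\,d(x)^{p-1}$ for $|x|>1$ and is bounded on $[-1,1]$. Then $e^{-V}$ is Lebesgue integrable, $V$ is not convex (so the probability measure $d\mu=\frac{e^{-V}}{\int e^{-V}d\lambda}\,d\lambda$, with $\lambda$ the Lebesgue measure on $\mathbb R$, is given by a density that is not log-concave), and $\mu$ satisfies the modified log-Sobolev inequality MLS$(H_q)$: there is a constant $C\in(0,\infty)$ such that for every $f\in C^\infty(\mathbb R)$ $$\int f^2\log\frac{f^2}{\int f^2d\mu}\,d\mu\ \le\ C\int H_q\!\left(\frac{|f'|}{f}\right)f^2\,d\mu ,\qquad H_q(x)=\begin{cases}x^2,&|x|\le 1,\\ |x|^q,&|x|\ge 1.\end{cases}$$ Here the inequality is understood to be void if the right-hand side is infinite; if the right-hand side is finite, then $\int f^2d\mu<\infty$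 and $f^2\log\frac{f^2}{\int f^2d\mu}$ is $\mu$-integrable. The integrand on the right is read as $0$ where $f=0$, and that on the left is read as $0$ where $f=0$. -/

import Mathlib

open MeasureTheory
open scoped ContDiff

namespace ModifiedLogSobolev

noncomputable section

/-- The modification `H_q` of `|x| ^ q`: quadratic on `[-1, 1]`, equal to `|x| ^ q` outside. -/
def modH (q x : ℝ) : ℝ :=
  if |x| ≤ 1 then x ^ 2 else |x| ^ q

/-- The energy density `H_q (|f'| / f) * f ^ 2`. It is `0` where `f` vanishes; for differentiable
`f` this convention is immaterial, since `{x | f x = 0 ∧ f' x ≠ 0}` is countable. -/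
def energyDensity (q : ℝ) (f : ℝ → ℝ) (x : ℝ) : ℝ :=
  modH q (|deriv f x| / f x) * f x ^ 2

/-- The integrand `f ^ 2 * log (f ^ 2 / μ (f ^ 2))` of the entropy of `f ^ 2`. -/
def entropyDensity (μ : Measure ℝ) (f : ℝ → ℝ) (x : ℝ) : ℝ :=
  f x ^ 2 * Real.log (f x ^ 2 / ∫ y, f y ^ 2 ∂μ)

/-- The inequality MLS(H_q) for a measure on the real line: one constant `C` works for all smooth
`f`. If the right-hand side is infinite there is nothing to say about `f`; if it is finite, the
left-hand side has to be meaningful (both integrals in it converge) and the inequality holds. -/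
def SatisfiesMLS (q : ℝ) (μ : Measure ℝ) : Prop :=
  ∃ C : ℝ, 0 < C ∧ ∀ f : ℝ → ℝ, ContDiff ℝ ∞ f → Integrable (energyDensity q f) μ →
    Integrable (fun x => f x ^ 2) μ ∧
    Integrable (entropyDensity μ f) μ ∧
    ∫ x, entropyDensity μ f x ∂μ ≤ C * ∫ x, energyDensity q f x ∂μ

/-- The measure `e^{-V} dλ / ∫ e^{-V} dλ` on the real line, `λ` being Lebesgue measure. -/
def gibbs (V : ℝ → ℝ) : Measure ℝ :=
  volume.withDensity fun x => ENNReal.ofReal (Real.exp (-V x) / ∫ y, Real.exp (-V y))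

end

end ModifiedLogSobolev

namespace ModifiedLogSobolev

open Set Filter Topology

/-! Convexity of `V` plays no role: all that matters is `V' ≥ c d ^ (p - 1)` far out (after
reflection on the left) and `V ≤ M (1 + d ^ p)`, where `d = |x - x₀|`. Write `m² = ∫ f² dμ`, `D = ∫
f'² dμ`, and `E` for the energy. The function `η = f² log (f² / m²) - f² + m²` is nonnegative and
has the entropy as its integral.

Where `|f| ≤ 4m`, `η ≤ 9 (|f| - m)²`, and a Poincaré inequality (`HasPowerGrowth.poincare`) bounds
this by `E`, since `H_q (y) ≥ y²`. Where `|f|` is larger, Cauchy–Schwarz shows that `f` grows at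
most like `exp (O(d ^ p))`, so `log (f² / m²) ≤ s + (M + 1) d ^ p + D / m²` (`log_sq_div_le`). It
remains to integrate `f² d ^ p` over the large values of `f`.

This is the U-bound (`HasPowerGrowth.integral_cutoff_mul_rpow`). Replace `f²` by a cutoff `G(f)`
vanishing for `|f| ≤ 2m`, and integrate by parts against `e^{-V}`: `V'` produces `G d ^ p`, while
Young's inequality with exponents `q` and `q / (q - 1) ≤ p` splits `G'(f) f' d` into energy and a
small multiple of `G d ^ p`. Because `G ≤ 8 (|f| - m)²`, the leftover `∫ G` is again a Poincaré
term, so no defect remains.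

Convexity fails because the oscillating part of `V'` has the same order as `V'` itself. -/

/-- The unnormalised Gibbs measure `e^{-V} dλ`. -/
noncomputable def expMeasure (V : ℝ → ℝ) : Measure ℝ :=
  volume.withDensity fun x => ENNReal.ofReal (Real.exp (-V x))

/-! ### Potentials of power growth -/

/-- On `[x₀ + R, ∞)` the potential `V` is `C¹` with `V' ≥ c (x - x₀) ^ (p - 1)`. -/
structure HasRightTail (V : ℝ → ℝ) (x₀ R c p : ℝ) : Prop where
  exists_deriv : ∃ v : ℝ → ℝ, (∀ x, x₀ + R ≤ x → HasDerivAt V (v x) x) ∧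
    ContinuousOn v (Ici (x₀ + R)) ∧ ∀ x, x₀ + R ≤ x → c * (x - x₀) ^ (p - 1) ≤ v x

/-- Potentials growing like `|x - x₀| ^ p`, with matching growth of the derivative far out. -/
structure HasPowerGrowth (V : ℝ → ℝ) (x₀ R c M p : ℝ) : Prop where
  one_le_R : 1 ≤ R
  c_pos : 0 < c
  M_nonneg : 0 ≤ M
  one_le_p : 1 ≤ p
  aemeasurable : AEMeasurable V
  le_power : ∀ x, V x ≤ M * (1 + |x - x₀| ^ p)
  right_tail : HasRightTail V x₀ R c p
  left_tail : HasRightTail (fun x => V (-x)) (-x₀) R c p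

/-- The hypotheses are symmetric under `x ↦ -x`, so tail estimates need proof on the right only. -/
lemma HasPowerGrowth.reflect {V : ℝ → ℝ} {x₀ R c M p : ℝ} (h : HasPowerGrowth V x₀ R c M p) :
    HasPowerGrowth (fun x => V (-x)) (-x₀) R c M p where
  one_le_R := h.one_le_R
  c_pos := h.c_pos
  M_nonneg := h.M_nonneg
  one_le_p := h.one_le_p
  aemeasurable := h.aemeasurable.comp_quasiMeasurePreserving
    (Measure.measurePreserving_neg volume).quasiMeasurePreserving
  le_power x := by
    have := h.le_power (-x)
    rwa [show -x - x₀ = -(x - -x₀) by ring, abs_neg] at this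
  right_tail := h.left_tail
  left_tail := by simpa using h.right_tail

/-! ### Integration against `e^{-V} dλ`, reflection, integration by parts -/

lemma integrableOn_expMeasure_iff {V : ℝ → ℝ} (hV : AEMeasurable V) {s : Set ℝ}
    (hs : MeasurableSet s) (F : ℝ → ℝ) :
    IntegrableOn F s (expMeasure V) ↔ IntegrableOn (fun x => Real.exp (-V x) * F x) s := by
  rw [IntegrableOn, expMeasure, restrict_withDensity hs,
    integrable_withDensity_iff_integrable_smul₀' (by fun_prop) (by simp)]
  simp [IntegrableOn, ENNReal.toReal_ofReal (Real.exp_pos _).le]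

lemma setIntegral_expMeasure {V : ℝ → ℝ} (hV : AEMeasurable V) {s : Set ℝ}
    (hs : MeasurableSet s) (F : ℝ → ℝ) :
    ∫ x in s, F x ∂(expMeasure V) = ∫ x in s, Real.exp (-V x) * F x := by
  rw [expMeasure, setIntegral_withDensity_eq_setIntegral_toReal_smul₀ (by fun_prop) (by simp) _ hs]
  simp [ENNReal.toReal_ofReal (Real.exp_pos _).le]

lemma measurePreserving_neg_expMeasure (V : ℝ → ℝ) :
    MeasurePreserving (fun x : ℝ => -x) (expMeasure fun x => V (-x)) (expMeasure V) := by
  refine ⟨measurable_neg, ?_⟩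
  ext s hs
  rw [Measure.map_apply measurable_neg hs, expMeasure, expMeasure,
    withDensity_apply _ (measurable_neg hs), withDensity_apply _ hs]
  exact (Measure.measurePreserving_neg (volume : Measure ℝ)).setLIntegral_comp_preimage_emb
    (Homeomorph.neg ℝ).measurableEmbedding (fun x => ENNReal.ofReal (Real.exp (-V x))) s

lemma integrableOn_Ioi_comp_neg_expMeasure {V F : ℝ → ℝ} {a : ℝ} :
    IntegrableOn (fun x => F (-x)) (Ioi a) (expMeasure fun x => V (-x)) ↔
      IntegrableOn F (Iio (-a)) (expMeasure V) := by
  have := (measurePreserving_neg_expMeasure V).integrableOn_comp_preimage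
    (Homeomorph.neg ℝ).measurableEmbedding (f := F) (s := Iio (-a))
  rw [← this]
  simp [Function.comp_def]

lemma setIntegral_Ioi_comp_neg_expMeasure (V F : ℝ → ℝ) (a : ℝ) :
    ∫ x in Ioi a, F (-x) ∂(expMeasure fun x => V (-x)) = ∫ x in Iio (-a), F x ∂(expMeasure V) := by
  have := (measurePreserving_neg_expMeasure V).setIntegral_preimage_emb
    (Homeomorph.neg ℝ).measurableEmbedding F (Iio (-a))
  rw [← this]
  simp

/-- Integration by parts against `e^{-V}` on a half line. -/
lemma setIntegral_Ioi_le_of_deriv_sub_le {V v H H' Q W : ℝ → ℝ} {a : ℝ} (hVm : AEMeasurable V)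
    (hV : ∀ x, a ≤ x → HasDerivAt V (v x) x) (hv : ContinuousOn v (Ici a))
    (hH : ∀ x, HasDerivAt H (H' x) x) (hH' : Continuous H') (hHa : H a = 0)
    (hH0 : ∀ x, a ≤ x → 0 ≤ H x) (hW : ContinuousOn W (Ici a)) (hW0 : ∀ x, a ≤ x → 0 ≤ W x)
    (hQ0 : ∀ x, a ≤ x → 0 ≤ Q x)
    (hQ : IntegrableOn Q (Ioi a) (expMeasure V))
    (hle : ∀ x, a ≤ x → H' x - H x * v x ≤ Q x - W x) :
    IntegrableOn W (Ioi a) (expMeasure V) ∧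
      ∫ x in Ioi a, W x ∂(expMeasure V) ≤ ∫ x in Ioi a, Q x ∂(expMeasure V) := by
  rw [integrableOn_expMeasure_iff hVm measurableSet_Ioi] at hQ ⊢
  rw [setIntegral_expMeasure hVm measurableSet_Ioi, setIntegral_expMeasure hVm measurableSet_Ioi]
  have hVc : ContinuousOn V (Ici a) := fun x hx => (hV x hx).continuousAt.continuousWithinAt
  have hρ : ContinuousOn (fun x => Real.exp (-V x)) (Ici a) := hVc.neg.rexp
  have hHc : Continuous H := continuous_iff_continuousAt.2 fun x => (hH x).continuousAt
  have hWρ : ContinuousOn (fun x => Real.exp (-V x) * W x) (Ici a) := hρ.mul hW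
  have sub : ∀ N, a ≤ N → uIcc a N ⊆ Ici a := fun N hN => by
    rw [uIcc_of_le hN]; exact Icc_subset_Ici_self
  have key : ∀ N, a ≤ N → ∫ x in a..N, Real.exp (-V x) * W x ≤
      ∫ x in Ioi a, Real.exp (-V x) * Q x := by
    intro N hN
    have hQi : IntervalIntegrable (fun x => Real.exp (-V x) * Q x) volume a N := by
      rw [intervalIntegrable_iff_integrableOn_Ioc_of_le hN]
      exact hQ.mono_set Ioc_subset_Ioi_self
    have hWi : IntervalIntegrable (fun x => Real.exp (-V x) * W x) volume a N :=
      (hWρ.mono (sub N hN)).intervalIntegrable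
    have hDc : ContinuousOn (fun x => Real.exp (-V x) * (H' x - H x * v x)) (Ici a) :=
      hρ.mul (hH'.continuousOn.sub (hHc.continuousOn.mul hv))
    have hDi := (hDc.mono (sub N hN)).intervalIntegrable (μ := volume)
    have hftc := intervalIntegral.integral_eq_sub_of_hasDerivAt
      (f := fun x => H x * Real.exp (-V x))
      (f' := fun x => Real.exp (-V x) * (H' x - H x * v x)) (a := a) (b := N)
      (fun x hx => ((hH x).mul (hV x (sub N hN hx)).fun_neg.exp).congr_deriv (by ring)) hDi
    -- The boundary term at `a` vanishes and the one at `N` has a favourable sign, so no decay of `H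
    -- e^{-V}` at infinity is needed.
    have h1 : 0 ≤ ∫ x in a..N, Real.exp (-V x) * (H' x - H x * v x) := by
      rw [hftc, hHa]
      have := mul_nonneg (hH0 N hN) (Real.exp_pos (-V N)).le
      linarith
    have h2 : ∫ x in a..N, Real.exp (-V x) * (H' x - H x * v x) ≤
        ∫ x in a..N, (Real.exp (-V x) * Q x - Real.exp (-V x) * W x) := by
      refine intervalIntegral.integral_mono_on hN hDi (hQi.sub hWi) fun x hx => ?_
      rw [← mul_sub]
      exact mul_le_mul_of_nonneg_left (hle x hx.1) (Real.exp_pos _).le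
    rw [intervalIntegral.integral_sub hQi hWi] at h2
    have h3 : ∫ x in a..N, Real.exp (-V x) * Q x ≤ ∫ x in Ioi a, Real.exp (-V x) * Q x := by
      rw [intervalIntegral.integral_of_le hN]
      refine setIntegral_mono_set hQ ?_ Ioc_subset_Ioi_self.eventuallyLE
      filter_upwards [ae_restrict_mem measurableSet_Ioi] with x hx
      exact mul_nonneg (Real.exp_pos _).le (hQ0 x (le_of_lt hx))
    linarith
  -- Integrability of `W` is a conclusion: `W ≥ 0` and its integrals over `[a, N]` are bounded
  -- uniformly in `N`.
  have hint : IntegrableOn (fun x => Real.exp (-V x) * W x) (Ioi a) := by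
    refine integrableOn_Ioi_of_intervalIntegral_norm_bounded (l := atTop) (b := id)
      (∫ x in Ioi a, Real.exp (-V x) * Q x) a (fun N => ?_) tendsto_id ?_
    · exact ((hWρ.mono Icc_subset_Ici_self).integrableOn_Icc).mono_set Ioc_subset_Icc_self
    · filter_upwards [eventually_ge_atTop a] with N hN
      refine le_trans (le_of_eq ?_) (key N hN)
      refine intervalIntegral.integral_congr fun x hx => ?_
      have hx' := sub N hN hx
      exact Real.norm_of_nonneg (mul_nonneg (Real.exp_pos _).le (hW0 x hx'))
  exact ⟨hint, le_of_tendsto (intervalIntegral_tendsto_integral_Ioi a hint tendsto_id)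
    ((eventually_ge_atTop a).mono key)⟩

/-- Cauchy–Schwarz, in the form that `f'` has nonnegative variance about its mean slope `r`. -/
lemma sq_sub_le_mul_integral_sq {f f' : ℝ → ℝ} (hf : ∀ x, HasDerivAt f (f' x) x)
    (hf' : Continuous f') {s t : ℝ} (hst : s ≤ t) :
    (f t - f s) ^ 2 ≤ (t - s) * ∫ x in s..t, f' x ^ 2 := by
  rcases hst.eq_or_lt with rfl | hlt
  · simp
  have hI : ∫ x in s..t, f' x = f t - f s :=
    intervalIntegral.integral_eq_sub_of_hasDerivAt (fun x _ => hf x)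
      (hf'.intervalIntegrable _ _)
  set r := (f t - f s) / (t - s) with hr
  have h0 : 0 ≤ ∫ x in s..t, (f' x - r) ^ 2 :=
    intervalIntegral.integral_nonneg hst fun x _ => sq_nonneg _
  have h1 : ∫ x in s..t, (f' x - r) ^ 2 =
      (∫ x in s..t, f' x ^ 2) - 2 * r * (f t - f s) + r ^ 2 * (t - s) := by
    have : ∀ x, (f' x - r) ^ 2 = f' x ^ 2 - 2 * r * f' x + r ^ 2 := fun x => by ring
    simp_rw [this]
    rw [intervalIntegral.integral_add (by apply Continuous.intervalIntegrable; fun_prop) (by simp),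
      intervalIntegral.integral_sub (by apply Continuous.intervalIntegrable; fun_prop)
        (by apply Continuous.intervalIntegrable; fun_prop),
      intervalIntegral.integral_const_mul, hI, intervalIntegral.integral_const, smul_eq_mul]
    ring
  have hd : 0 < t - s := sub_pos.2 hlt
  have h2 : r * (t - s) = f t - f s := div_mul_cancel₀ _ hd.ne'
  have h3 : (t - s) * ((∫ x in s..t, f' x ^ 2) - 2 * r * (f t - f s) + r ^ 2 * (t - s)) =
      (t - s) * (∫ x in s..t, f' x ^ 2) - (f t - f s) ^ 2 := by
    rw [← h2]; ring
  have := mul_nonneg hd.le (h1 ▸ h0)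
  linarith

/-! ### Oscillation bounds and the Poincaré inequality -/

section Growth

variable {V : ℝ → ℝ} {x₀ R c M p : ℝ}

/-- Between `x₀` and `x` the density is at least `exp (-M (1 + |x - x₀| ^ p))`, so Lebesgue
integrals of `f'²` there cost at most the reciprocal factor. This serves both the middle interval
and the logarithmic growth of `f`. -/
lemma HasPowerGrowth.sq_sub_le (h : HasPowerGrowth V x₀ R c M p) {f f' : ℝ → ℝ}
    (hf : ∀ x, HasDerivAt f (f' x) x) (hf' : Continuous f')
    (hD : Integrable (fun x => f' x ^ 2) (expMeasure V)) (x : ℝ) :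
    (f x - f x₀) ^ 2 ≤ |x - x₀| * Real.exp (M * (1 + |x - x₀| ^ p)) *
      ∫ x, f' x ^ 2 ∂(expMeasure V) := by
  have main : ∀ s t : ℝ, s ≤ t → (∀ y ∈ Ioc s t, |y - x₀| ≤ |x - x₀|) →
      (f t - f s) ^ 2 ≤ (t - s) * (Real.exp (M * (1 + |x - x₀| ^ p)) *
      ∫ x, f' x ^ 2 ∂(expMeasure V)) := by
    intro s t hst hy
    refine (sq_sub_le_mul_integral_sq hf hf' hst).trans ?_
    refine mul_le_mul_of_nonneg_left ?_ (sub_nonneg.2 hst)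
    have hD' := (integrableOn_expMeasure_iff h.aemeasurable measurableSet_Ioc _).1
      (hD.integrableOn (s := Ioc s t))
    calc ∫ x in s..t, f' x ^ 2 = ∫ x in Ioc s t, f' x ^ 2 :=
          intervalIntegral.integral_of_le hst
      _ ≤ ∫ y in Ioc s t, Real.exp (M * (1 + |x - x₀| ^ p)) * (Real.exp (-V y) * f' y ^ 2) := by
          refine setIntegral_mono_on ?_ (hD'.const_mul _) measurableSet_Ioc fun y hyI => ?_
          · exact ((hf'.pow 2).continuousOn.integrableOn_Icc).mono_set Ioc_subset_Icc_self
          · rw [← mul_assoc, ← Real.exp_add]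
            refine le_mul_of_one_le_left (sq_nonneg _) (Real.one_le_exp ?_)
            have h1 := h.le_power y
            have h2 : |y - x₀| ^ p ≤ |x - x₀| ^ p :=
              Real.rpow_le_rpow (abs_nonneg _) (hy y hyI) (by linarith [h.one_le_p])
            have h3 := mul_le_mul_of_nonneg_left h2 h.M_nonneg
            linarith
      _ = Real.exp (M * (1 + |x - x₀| ^ p)) * ∫ y in Ioc s t, f' y ^ 2 ∂(expMeasure V) := by
          rw [integral_const_mul, setIntegral_expMeasure h.aemeasurable measurableSet_Ioc]
      _ ≤ _ := by
          refine mul_le_mul_of_nonneg_left ?_ (Real.exp_pos _).le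
          exact setIntegral_le_integral hD (ae_of_all _ fun y => sq_nonneg _)
  rcases le_total x₀ x with hx | hx
  · have := main x₀ x hx fun y hy => by
      rw [abs_of_nonneg (by linarith [hy.1]), abs_of_nonneg (by linarith)]; linarith [hy.2]
    rwa [abs_of_nonneg (by linarith : 0 ≤ x - x₀), mul_assoc,
      ← abs_of_nonneg (by linarith : 0 ≤ x - x₀)] at *
  · have := main x x₀ hx fun y hy => by
      rw [abs_of_nonpos (by linarith [hy.2]), abs_of_nonpos (by linarith)]; linarith [hy.1]
    rw [mul_assoc, show |x - x₀| = x₀ - x by rw [abs_of_nonpos (by linarith)]; ring,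
      show (f x - f x₀) ^ 2 = (f x₀ - f x) ^ 2 by ring]
    rwa [show |x - x₀| = x₀ - x by rw [abs_of_nonpos (by linarith)]; ring] at this

lemma HasPowerGrowth.le_deriv (h : HasPowerGrowth V x₀ R c M p) {x : ℝ} (hx : x₀ + R ≤ x) :
    c ≤ c * (x - x₀) ^ (p - 1) :=
  le_mul_of_one_le_right h.c_pos.le
    (Real.one_le_rpow (by linarith [h.one_le_R]) (by linarith [h.one_le_p]))

/-- The pointwise oscillation constant on `[x₀ - R, x₀ + R]`. -/
noncomputable def oscConst (R M p : ℝ) : ℝ := R * Real.exp (M * (1 + R ^ p))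

lemma HasPowerGrowth.oscConst_nonneg (h : HasPowerGrowth V x₀ R c M p) : 0 ≤ oscConst R M p :=
  mul_nonneg (by linarith [h.one_le_R]) (Real.exp_pos _).le

lemma HasPowerGrowth.sq_sub_le_oscConst (h : HasPowerGrowth V x₀ R c M p) {f f' : ℝ → ℝ}
    (hf : ∀ x, HasDerivAt f (f' x) x) (hf' : Continuous f')
    (hD : Integrable (fun x => f' x ^ 2) (expMeasure V)) {x : ℝ} (hx : |x - x₀| ≤ R) :
    (f x - f x₀) ^ 2 ≤ oscConst R M p * ∫ x, f' x ^ 2 ∂(expMeasure V) := by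
  refine (h.sq_sub_le hf hf' hD x).trans ?_
  refine mul_le_mul_of_nonneg_right ?_ (integral_nonneg fun y => sq_nonneg _)
  refine mul_le_mul hx (Real.exp_le_exp.2 ?_) (Real.exp_pos _).le (by linarith [h.one_le_R])
  refine mul_le_mul_of_nonneg_left ?_ h.M_nonneg
  have := Real.rpow_le_rpow (abs_nonneg _) hx (by linarith [h.one_le_p] : 0 ≤ p)
  linarith

/-- On the tail `V' ≥ c`. Integrating by parts with `H = (f - f a)²` and completing the square in `2
(f - f a) f'` bounds `∫ (f - f a)²`; passing from `f a` to `f x₀` costs the oscillation on `[x₀,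
a]`. -/
lemma HasPowerGrowth.poincare_Ioi (h : HasPowerGrowth V x₀ R c M p)
    [IsProbabilityMeasure (expMeasure V)] {f f' : ℝ → ℝ}
    (hf : ∀ x, HasDerivAt f (f' x) x) (hf' : Continuous f')
    (hD : Integrable (fun x => f' x ^ 2) (expMeasure V)) :
    IntegrableOn (fun x => (f x - f x₀) ^ 2) (Ioi (x₀ + R)) (expMeasure V) ∧
    ∫ x in Ioi (x₀ + R), (f x - f x₀) ^ 2 ∂(expMeasure V) ≤
      (8 / c ^ 2 + 2 * oscConst R M p) * ∫ x, f' x ^ 2 ∂(expMeasure V) := by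
  obtain ⟨v, hv, hvc, hvl⟩ := h.right_tail.exists_deriv
  have hc := h.c_pos
  set a := x₀ + R with ha
  have hfc : Continuous f := continuous_iff_continuousAt.2 fun x => (hf x).continuousAt
  obtain ⟨h1, h2⟩ := setIntegral_Ioi_le_of_deriv_sub_le (V := V) (v := v)
    (H := fun x => (f x - f a) ^ 2) (H' := fun x => 2 * (f x - f a) * f' x)
    (Q := fun x => 2 / c * f' x ^ 2) (W := fun x => c / 2 * (f x - f a) ^ 2)
    h.aemeasurable hv hvc
    (fun x => (((hf x).sub_const (f a)).fun_pow 2).congr_deriv (by push_cast; ring))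
    (by fun_prop) (by simp) (fun x _ => sq_nonneg _)
    (by fun_prop) (fun x _ => by positivity) (fun x _ => by positivity)
    (hD.integrableOn.const_mul _) (fun x hx => by
      have hvx : c ≤ v x := (h.le_deriv hx).trans (hvl x hx)
      have e1 := mul_le_mul_of_nonneg_left hvx (sq_nonneg (f x - f a))
      have e2 : 2 / c * f' x ^ 2 - c / 2 * (f x - f a) ^ 2 -
          (2 * (f x - f a) * f' x - (f x - f a) ^ 2 * c) =
          2 / c * (f' x - c / 2 * (f x - f a)) ^ 2 := by field_simp; ring
      have e3 : 0 ≤ 2 / c * (f' x - c / 2 * (f x - f a)) ^ 2 := by positivity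
      linarith)
  have h1' : IntegrableOn (fun x => (f x - f a) ^ 2) (Ioi a) (expMeasure V) := by
    refine (h1.const_mul (2 / c)).congr (ae_of_all _ fun x => ?_)
    simp only []
    field_simp
  have hosc := h.sq_sub_le_oscConst hf hf' hD (x := a)
    (by rw [ha, add_sub_cancel_left, abs_of_nonneg (by linarith [h.one_le_R])])
  set D := ∫ x, f' x ^ 2 ∂(expMeasure V) with hDdef
  have hDtail : ∫ x in Ioi a, f' x ^ 2 ∂(expMeasure V) ≤ D :=
    setIntegral_le_integral hD (ae_of_all _ fun y => sq_nonneg _)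
  have hpt : ∀ x, (f x - f x₀) ^ 2 ≤ 2 * (f x - f a) ^ 2 + 2 * (oscConst R M p * D) := fun x => by
    nlinarith [sq_nonneg ((f x - f a) - (f a - f x₀))]
  have hdom : IntegrableOn (fun x => 2 * (f x - f a) ^ 2 + 2 * (oscConst R M p * D))
      (Ioi a) (expMeasure V) := (h1'.const_mul 2).add (integrable_const _)
  have hint : IntegrableOn (fun x => (f x - f x₀) ^ 2) (Ioi a) (expMeasure V) := by
    refine hdom.mono' (by fun_prop) (ae_of_all _ fun x => ?_)
    rw [Real.norm_of_nonneg (sq_nonneg _)]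
    exact hpt x
  refine ⟨hint, (integral_mono hint hdom hpt).trans ?_⟩
  rw [integral_add (h1'.const_mul 2) (integrable_const _), integral_const_mul]
  rw [integral_const_mul, integral_const_mul] at h2
  have hK : 0 ≤ 2 * (oscConst R M p * D) :=
    mul_nonneg zero_le_two (mul_nonneg h.oscConst_nonneg (integral_nonneg fun y => sq_nonneg _))
  have h3 : ∫ _ in Ioi a, 2 * (oscConst R M p * D) ∂(expMeasure V) ≤
      2 * (oscConst R M p * D) := by
    rw [integral_const, smul_eq_mul]
    exact mul_le_of_le_one_left hK (by simp)
  have h4 : ∫ x in Ioi a, (f x - f a) ^ 2 ∂(expMeasure V) ≤ 4 / c ^ 2 * D := by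
    have := mul_le_mul_of_nonneg_left (h2.trans (mul_le_mul_of_nonneg_left hDtail (by positivity)))
      (by positivity : 0 ≤ 2 / c)
    have e1 : ∀ y, 2 / c * (c / 2 * y) = y := fun y => by field_simp
    have e2 : 2 / c * (2 / c * D) = 4 / c ^ 2 * D := by field_simp; ring
    rwa [e1, e2] at this
  have e3 : (8 / c ^ 2 + 2 * oscConst R M p) * D =
    2 * (4 / c ^ 2 * D) + 2 * (oscConst R M p * D) := by ring
  rw [e3]
  linarith

lemma isProbabilityMeasure_expMeasure_neg (V : ℝ → ℝ) [IsProbabilityMeasure (expMeasure V)] :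
    IsProbabilityMeasure (expMeasure fun x => V (-x)) := by
  have := measurePreserving_neg_expMeasure (fun x => V (-x))
  simp only [neg_neg] at this
  rw [← this.map_eq]
  exact Measure.isProbabilityMeasure_map this.aemeasurable

lemma integrable_comp_neg_expMeasure {F : ℝ → ℝ} (hF : Integrable F (expMeasure V)) :
    Integrable (fun x => F (-x)) (expMeasure fun x => V (-x)) :=
  (measurePreserving_neg_expMeasure V).integrable_comp_of_integrable hF

lemma integral_comp_neg_expMeasure (F : ℝ → ℝ) :
    ∫ x, F (-x) ∂(expMeasure fun x => V (-x)) = ∫ x, F x ∂(expMeasure V) :=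
  (measurePreserving_neg_expMeasure V).integral_comp (Homeomorph.neg ℝ).measurableEmbedding F

/-- Gluing estimates on the two tails and in the middle. -/
lemma integral_le_of_tails {μ : Measure ℝ} {F : ℝ → ℝ} {a b A B C : ℝ} (hab : a ≤ b)
    (hr : IntegrableOn F (Ioi b) μ ∧ ∫ x in Ioi b, F x ∂μ ≤ A)
    (hl : IntegrableOn F (Iio a) μ ∧ ∫ x in Iio a, F x ∂μ ≤ B)
    (hm : IntegrableOn F (Icc a b) μ ∧ ∫ x in Icc a b, F x ∂μ ≤ C) :
    Integrable F μ ∧ ∫ x, F x ∂μ ≤ A + B + C := by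
  have hu : (Iio a ∪ Icc a b) ∪ Ioi b = univ := by
    rw [Iio_union_Icc_eq_Iic hab, Iic_union_Ioi]
  have hint : Integrable F μ := by
    rw [← integrableOn_univ, ← hu]
    exact (hl.1.union hm.1).union hr.1
  refine ⟨hint, ?_⟩
  rw [← setIntegral_univ, ← hu, setIntegral_union _ measurableSet_Ioi (hl.1.union hm.1) hr.1,
    setIntegral_union _ measurableSet_Icc hl.1 hm.1]
  · linarith [hr.2, hl.2, hm.2]
  · rw [Set.disjoint_left]; intro x hx hx'; exact absurd hx'.1 (not_le.2 hx)
  · rw [Iio_union_Icc_eq_Iic hab, Set.disjoint_left]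
    intro x hx hx'; exact (mem_Iic.1 hx).not_gt (mem_Ioi.1 hx')

/-- Centring at `f x₀` instead of the mean avoids assuming `f` integrable; `f ∈ L²` then follows
from finite energy. -/
lemma HasPowerGrowth.poincare (h : HasPowerGrowth V x₀ R c M p)
    [IsProbabilityMeasure (expMeasure V)] :
    ∃ C : ℝ, 0 ≤ C ∧ ∀ f f' : ℝ → ℝ, (∀ x, HasDerivAt f (f' x) x) → Continuous f' →
      Integrable (fun x => f' x ^ 2) (expMeasure V) →
      Integrable (fun x => (f x - f x₀) ^ 2) (expMeasure V) ∧
      ∫ x, (f x - f x₀) ^ 2 ∂(expMeasure V) ≤ C * ∫ x, f' x ^ 2 ∂(expMeasure V) := by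
  have hosc := h.oscConst_nonneg
  refine ⟨(8 / c ^ 2 + 2 * oscConst R M p) + (8 / c ^ 2 + 2 * oscConst R M p) + oscConst R M p,
    by positivity, fun f f' hf hf' hD => ?_⟩
  have hfc : Continuous f := continuous_iff_continuousAt.2 fun x => (hf x).continuousAt
  have := isProbabilityMeasure_expMeasure_neg V
  have hleft := h.reflect.poincare_Ioi (f := fun x => f (-x)) (f' := fun x => -f' (-x))
    (fun x => ((hf (-x)).comp x (hasDerivAt_neg x)).congr_deriv (by ring)) (by fun_prop)
    (by simpa using integrable_comp_neg_expMeasure hD)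
  simp only [neg_neg, neg_sq] at hleft
  rw [integrableOn_Ioi_comp_neg_expMeasure (F := fun x => (f x - f x₀) ^ 2),
    setIntegral_Ioi_comp_neg_expMeasure V (fun x => (f x - f x₀) ^ 2),
    integral_comp_neg_expMeasure (fun x => f' x ^ 2),
    show -(-x₀ + R) = x₀ - R by ring] at hleft
  rw [add_mul, add_mul (8 / c ^ 2 + 2 * oscConst R M p)]
  refine integral_le_of_tails (by linarith [h.one_le_R])
    (h.poincare_Ioi hf hf' hD) hleft ?_
  have hpt : ∀ x ∈ Icc (x₀ - R) (x₀ + R), (f x - f x₀) ^ 2 ≤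
      oscConst R M p * ∫ x, f' x ^ 2 ∂(expMeasure V) := fun x hx =>
    h.sq_sub_le_oscConst hf hf' hD (abs_le.2 ⟨by linarith [hx.1], by linarith [hx.2]⟩)
  have hK : 0 ≤ oscConst R M p * ∫ x, f' x ^ 2 ∂(expMeasure V) :=
    mul_nonneg hosc (integral_nonneg fun y => sq_nonneg _)
  have hint : IntegrableOn (fun x => (f x - f x₀) ^ 2) (Icc (x₀ - R) (x₀ + R))
      (expMeasure V) := by
    refine Integrable.mono' (integrable_const (oscConst R M p * ∫ x, f' x ^ 2 ∂(expMeasure V)))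
      (by fun_prop) ?_
    filter_upwards [ae_restrict_mem measurableSet_Icc] with x hx
    rw [Real.norm_of_nonneg (sq_nonneg _)]
    exact hpt x hx
  refine ⟨hint, (setIntegral_mono_on hint (integrable_const _) measurableSet_Icc hpt).trans ?_⟩
  rw [integral_const, smul_eq_mul]
  exact mul_le_of_le_one_left hK (by simp)

end Growth

/-! ### The cutoff of the square -/

/-- Since `q > 1`, the derivative away from `0` extends continuously to `0`, which forces
differentiability there. -/
lemma hasDerivAt_max_zero_rpow {q : ℝ} (hq : 1 < q) (y : ℝ) :
    HasDerivAt (fun y => max y 0 ^ q) (q * max y 0 ^ (q - 1)) y := by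
  refine hasDerivAt_of_hasDerivAt_of_ne' (f := fun y : ℝ => max y 0 ^ q)
    (g := fun y => q * max y 0 ^ (q - 1)) (x := 0) (fun y hy => ?_) ?_ ?_ y
  · rcases hy.lt_or_gt with h | h
    · rw [max_eq_right h.le, Real.zero_rpow (by linarith), mul_zero]
      refine (hasDerivAt_const y (0 : ℝ)).congr_of_eventuallyEq ?_
      filter_upwards [Iio_mem_nhds h] with z hz
      rw [max_eq_right (le_of_lt hz), Real.zero_rpow (by linarith)]
    · rw [max_eq_left h.le]
      refine (Real.hasDerivAt_rpow_const (Or.inl h.ne')).congr_of_eventuallyEq ?_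
      filter_upwards [Ioi_mem_nhds h] with z hz
      rw [max_eq_left (le_of_lt hz)]
  · exact ((continuous_id.max continuous_const).rpow_const
      fun _ => Or.inr (by linarith)).continuousAt
  · exact (continuous_const.mul ((continuous_id.max continuous_const).rpow_const
      fun _ => Or.inr (by linarith))).continuousAt

/-- The weight in `cutoff`: it vanishes for `|t| ≤ 2 m` and tends to `1` as `|t| → ∞`. -/
noncomputable def cutoffWeight (m t : ℝ) : ℝ := max ((t ^ 2 - 4 * m ^ 2) / (t ^ 2 + m ^ 2)) 0

/-- A `C¹` function comparable to `t ^ 2` for large `t` and vanishing to order `q` near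
`|t| = 2 m`. -/
noncomputable def cutoff (q m t : ℝ) : ℝ := (t ^ 2 + m ^ 2) * cutoffWeight m t ^ q

/-- The derivative of `cutoff`. -/
noncomputable def cutoffDeriv (q m t : ℝ) : ℝ :=
  2 * t * (cutoffWeight m t ^ q + 5 * q * m ^ 2 / (t ^ 2 + m ^ 2) * cutoffWeight m t ^ (q - 1))

section Cutoff

variable {q m : ℝ}

lemma cutoffWeight_nonneg (m t : ℝ) : 0 ≤ cutoffWeight m t := le_max_right _ _

lemma cutoffWeight_le_one (hm : 0 < m) (t : ℝ) : cutoffWeight m t ≤ 1 := by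
  refine max_le ?_ zero_le_one
  rw [div_le_one (by positivity)]
  nlinarith [sq_nonneg m]

lemma cutoff_nonneg (q m t : ℝ) : 0 ≤ cutoff q m t :=
  mul_nonneg (by positivity) (Real.rpow_nonneg (cutoffWeight_nonneg m t) q)

lemma cutoffWeight_eq_zero (hm : 0 < m) {t : ℝ} (ht : |t| ≤ 2 * m) : cutoffWeight m t = 0 := by
  refine max_eq_right (div_nonpos_of_nonpos_of_nonneg ?_ (by positivity))
  nlinarith [sq_abs t, abs_nonneg t]

lemma cutoff_eq_zero (hq : 0 < q) (hm : 0 < m) {t : ℝ} (ht : |t| ≤ 2 * m) : cutoff q m t = 0 := by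
  rw [cutoff, cutoffWeight_eq_zero hm ht, Real.zero_rpow hq.ne', mul_zero]

lemma cutoff_le (hq : 0 < q) (hm : 0 < m) (t : ℝ) : cutoff q m t ≤ 2 * t ^ 2 := by
  rcases le_total |t| (2 * m) with ht | ht
  · rw [cutoff_eq_zero hq hm ht]; positivity
  · have h1 : cutoff q m t ≤ (t ^ 2 + m ^ 2) * 1 := mul_le_mul_of_nonneg_left
      (Real.rpow_le_one (cutoffWeight_nonneg m t) (cutoffWeight_le_one hm t) hq.le) (by positivity)
    nlinarith [sq_abs t]

/-- On the support `|t| ≥ 2m`, so `|t| ≤ 2 (|t| - m)`. This is what makes the final inequality free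
of a defect. -/
lemma cutoff_le_sq_sub (hq : 0 < q) (hm : 0 < m) (t : ℝ) :
    cutoff q m t ≤ 8 * (|t| - m) ^ 2 := by
  rcases le_total |t| (2 * m) with ht | ht
  · rw [cutoff_eq_zero hq hm ht]; positivity
  · refine (cutoff_le hq hm t).trans ?_
    rw [← sq_abs t]
    nlinarith

lemma le_cutoff (hq : 0 < q) (hm : 0 < m) {t : ℝ} (ht : 4 * m ≤ |t|) :
    t ^ 2 ≤ 2 ^ q * cutoff q m t := by
  -- The weight reaches `1 / 2` already at `|t| = 3m`.
  have hw : 1 / 2 ≤ cutoffWeight m t := by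
    refine le_max_of_le_left ?_
    rw [div_le_div_iff₀ (by norm_num) (by positivity)]
    nlinarith [sq_abs t]
  have h1 : (1 / 2 : ℝ) ^ q ≤ cutoffWeight m t ^ q := Real.rpow_le_rpow (by norm_num) hw hq.le
  have h2 : (2 : ℝ) ^ q * (1 / 2) ^ q = 1 := by
    rw [← Real.mul_rpow (by norm_num) (by norm_num)]; norm_num
  have h3 : 0 < (2 : ℝ) ^ q := by positivity
  calc t ^ 2 ≤ (t ^ 2 + m ^ 2) * (2 ^ q * (1 / 2) ^ q) := by rw [h2]; nlinarith [sq_nonneg m]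
    _ ≤ (t ^ 2 + m ^ 2) * (2 ^ q * cutoffWeight m t ^ q) := by gcongr
    _ = _ := by rw [cutoff]; ring

/-- The quotient in the weight has derivative `10 t m² / (t² + m²)²`, whence the factor `5` in
`cutoffDeriv`. -/
lemma hasDerivAt_cutoff (hq : 1 < q) (hm : 0 < m) (t : ℝ) :
    HasDerivAt (cutoff q m) (cutoffDeriv q m t) t := by
  have hpos : t ^ 2 + m ^ 2 ≠ 0 := by positivity
  have h1 : HasDerivAt (fun t : ℝ => t ^ 2 + m ^ 2) (2 * t) t := by
    simpa using (hasDerivAt_pow 2 t).add_const (m ^ 2)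
  have h2 : HasDerivAt (fun t : ℝ => t ^ 2 - 4 * m ^ 2) (2 * t) t := by
    simpa using (hasDerivAt_pow 2 t).sub_const (4 * m ^ 2)
  have h3 := h1.mul ((hasDerivAt_max_zero_rpow hq _).comp t (h2.fun_div h1 hpos))
  refine h3.congr_deriv ?_
  simp only [Function.comp_apply, cutoffDeriv, cutoffWeight]
  field_simp
  ring

lemma continuous_cutoffWeight (hm : 0 < m) : Continuous (cutoffWeight m) := by
  unfold cutoffWeight
  exact (Continuous.div (by fun_prop) (by fun_prop) fun t => by positivity).max continuous_const

lemma continuous_cutoffDeriv (hq : 1 < q) (hm : 0 < m) : Continuous (cutoffDeriv q m) := by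
  unfold cutoffDeriv
  have h1 := (continuous_cutoffWeight hm).rpow_const (p := q) fun _ => Or.inr (by linarith)
  have h2 := (continuous_cutoffWeight hm).rpow_const (p := q - 1) fun _ => Or.inr (by linarith)
  refine (continuous_const.mul continuous_id).mul (h1.add (Continuous.mul ?_ h2))
  exact Continuous.div (by fun_prop) (by fun_prop) fun t => by positivity

/-- The power `w ^ (q - 1)` is the point of the construction: raised to the conjugate exponent `q /
(q - 1)` it becomes `w ^ q`, the factor in `cutoff` itself. -/
lemma abs_cutoffDeriv_le (hq : 1 < q) (hm : 0 < m) (t : ℝ) :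
    |cutoffDeriv q m t| ≤ 2 * (1 + 5 * q) * |t| * cutoffWeight m t ^ (q - 1) := by
  have hq0 : 0 < q := by linarith
  have hw0 := cutoffWeight_nonneg m t
  have h1 : cutoffWeight m t ^ q ≤ cutoffWeight m t ^ (q - 1) := by
    rcases hw0.eq_or_lt with h | h
    · rw [← h, Real.zero_rpow (by linarith), Real.zero_rpow (by linarith)]
    · exact Real.rpow_le_rpow_of_exponent_ge h (cutoffWeight_le_one hm t) (by linarith)
  have h2 : 5 * q * m ^ 2 / (t ^ 2 + m ^ 2) ≤ 5 * q := by
    rw [div_le_iff₀ (by positivity)]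
    have : 0 ≤ 5 * q * t ^ 2 := by positivity
    linarith
  have h0 : 0 ≤ cutoffWeight m t ^ (q - 1) := Real.rpow_nonneg hw0 _
  have h0' : 0 ≤ cutoffWeight m t ^ q := Real.rpow_nonneg hw0 _
  have hs : 0 ≤ cutoffWeight m t ^ q +
      5 * q * m ^ 2 / (t ^ 2 + m ^ 2) * cutoffWeight m t ^ (q - 1) := by positivity
  rw [cutoffDeriv, abs_mul, abs_mul, abs_of_nonneg (zero_le_two (α := ℝ)), abs_of_nonneg hs]
  have h3 := mul_le_mul_of_nonneg_right h2 h0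
  calc 2 * |t| * _ ≤ 2 * |t| * (cutoffWeight m t ^ (q - 1) + 5 * q * cutoffWeight m t ^ (q - 1)) :=
        mul_le_mul_of_nonneg_left (add_le_add h1 h3) (by positivity)
    _ = _ := by ring

end Cutoff

/-! ### Young's inequality and the U-bound -/

lemma mul_le_young {q ε : ℝ} (hq : 1 < q) (hε : 0 < ε) :
    ∃ K : ℝ, 0 ≤ K ∧ ∀ a b : ℝ, 0 ≤ a → 0 ≤ b → a * b ≤ K * a ^ q + ε * b ^ (q / (q - 1)) := by
  have hconj : q.HolderConjugate (q / (q - 1)) := Real.HolderConjugate.conjExponent hq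
  set r := q / (q - 1) with hr
  have hr0 : 0 < r := hconj.symm.pos
  have hr1 : 1 ≤ r := hconj.symm.lt.le
  refine ⟨(ε ^ (1 / r))⁻¹ ^ q, by positivity, fun a b ha hb => ?_⟩
  set δ := ε ^ (1 / r) with hδ
  have hδ0 : 0 < δ := by positivity
  have hδr : δ ^ r = ε := by rw [hδ, ← Real.rpow_mul hε.le, one_div_mul_cancel hr0.ne', Real.rpow_one]
  have h := Real.young_inequality_of_nonneg (a := δ⁻¹ * a) (b := δ * b)
    (by positivity) (by positivity) hconj
  rw [Real.mul_rpow (by positivity) ha, Real.mul_rpow hδ0.le hb, hδr] at h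
  have h1 : δ⁻¹ ^ q * a ^ q / q ≤ δ⁻¹ ^ q * a ^ q := div_le_self (by positivity) hq.le
  have h2 : ε * b ^ r / r ≤ ε * b ^ r := div_le_self (by positivity) hr1
  have h3 : δ⁻¹ * a * (δ * b) = a * b := by field_simp
  linarith

lemma modH_nonneg (q y : ℝ) : 0 ≤ modH q y := by
  unfold modH; split_ifs <;> positivity

lemma rpow_le_modH {q : ℝ} (hq : 2 ≤ q) (y : ℝ) : |y| ^ q ≤ modH q y := by
  unfold modH; split_ifs with h
  · rw [← sq_abs]
    rcases (abs_nonneg y).eq_or_lt with h0 | h0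
    · rw [← h0, Real.zero_rpow (by linarith)]; norm_num
    · have := Real.rpow_le_rpow_of_exponent_ge h0 h hq
      simpa using this
  · exact le_rfl

lemma sq_le_modH {q : ℝ} (hq : 2 ≤ q) (y : ℝ) : y ^ 2 ≤ modH q y := by
  unfold modH; split_ifs with h
  · exact le_rfl
  · rw [← sq_abs]
    have := Real.rpow_le_rpow_of_exponent_le (not_le.1 h).le hq
    simpa using this

lemma energyDensity_nonneg (q : ℝ) (f : ℝ → ℝ) (x : ℝ) : 0 ≤ energyDensity q f x :=
  mul_nonneg (modH_nonneg _ _) (sq_nonneg _)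

/-- Young is applied to `|f'| / |f|` and `w ^ (q - 1) d`, then multiplied by `f²`. Here `p ≥ q / (q
- 1)` enters, through `d ^ (q / (q - 1)) ≤ d ^ p` for `d ≥ 1`. The constant does not depend on `m`
or `f`. -/
lemma abs_cutoffDeriv_mul_le {q p ε : ℝ} (hq : 2 < q) (hp : q / (q - 1) ≤ p) (hε : 0 < ε) :
    ∃ K : ℝ, 0 ≤ K ∧ ∀ (m : ℝ) (f : ℝ → ℝ) (x d : ℝ), 0 < m → 1 ≤ d →
      |cutoffDeriv q m (f x) * deriv f x| * d ≤
        K * energyDensity q f x + ε * (cutoff q m (f x) * d ^ p) := by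
  obtain ⟨K₀, hK₀, hK⟩ := mul_le_young (by linarith : 1 < q) hε
  set L := 2 * (1 + 5 * q) with hL
  have hL0 : 0 < L := by rw [hL]; linarith
  refine ⟨K₀ * L ^ q, by positivity, fun m f x d hm hd => ?_⟩
  set w := cutoffWeight m (f x) with hw
  have hw0 : 0 ≤ w := cutoffWeight_nonneg _ _
  have hw1 : w ≤ 1 := cutoffWeight_le_one hm _
  have hG0 := cutoff_nonneg q m (f x)
  have he0 := energyDensity_nonneg q f x
  have hd0 : 0 ≤ d := by linarith
  have hrhs : 0 ≤ K₀ * L ^ q * energyDensity q f x + ε * (cutoff q m (f x) * d ^ p) := by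
    positivity
  have hbd := abs_cutoffDeriv_le (by linarith : 1 < q) hm (f x)
  rcases eq_or_ne (f x) 0 with hf | hf
  · refine le_trans (le_of_eq ?_) hrhs
    rw [hf, cutoffDeriv]; simp
  have hfa : 0 < |f x| := abs_pos.2 hf
  set A := |deriv f x| / |f x| with hA
  have hA0 : 0 ≤ A := by positivity
  have hB0 : 0 ≤ w ^ (q - 1) * d := by positivity
  have hy := hK (L * A) (w ^ (q - 1) * d) (by positivity) hB0
  have hB : (w ^ (q - 1) * d) ^ (q / (q - 1)) ≤ w ^ q * d ^ p := by
    rw [Real.mul_rpow (by positivity) hd0, ← Real.rpow_mul hw0,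
      mul_div_cancel₀ q (by linarith : q - 1 ≠ 0)]
    exact mul_le_mul_of_nonneg_left (Real.rpow_le_rpow_of_exponent_le hd hp) (by positivity)
  rw [Real.mul_rpow hL0.le hA0] at hy
  have hE : f x ^ 2 * A ^ q ≤ energyDensity q f x := by
    rw [energyDensity, mul_comm]
    refine mul_le_mul_of_nonneg_right ?_ (sq_nonneg _)
    refine le_trans (le_of_eq ?_) (rpow_le_modH hq.le _)
    rw [abs_div, abs_abs]
  have hG : f x ^ 2 * w ^ q ≤ cutoff q m (f x) := by
    rw [cutoff]
    exact mul_le_mul_of_nonneg_right (by linarith [sq_nonneg m]) (by positivity)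
  calc |cutoffDeriv q m (f x) * deriv f x| * d
      ≤ (L * |f x| * w ^ (q - 1)) * |deriv f x| * d := by
        rw [abs_mul]; gcongr
    _ = f x ^ 2 * (L * A * (w ^ (q - 1) * d)) := by
        rw [hA, ← sq_abs]; field_simp
    _ ≤ f x ^ 2 * (K₀ * (L ^ q * A ^ q) + ε * (w ^ q * d ^ p)) := by
        refine mul_le_mul_of_nonneg_left (hy.trans ?_) (sq_nonneg _)
        gcongr
    _ = K₀ * L ^ q * (f x ^ 2 * A ^ q) + ε * (f x ^ 2 * w ^ q * d ^ p) := by ring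
    _ ≤ _ := by gcongr

section Growth

variable {V : ℝ → ℝ} {x₀ R c M p q : ℝ}

/-- The weight `d - R` vanishes at the end of the tail. For `d ≥ 2R` it is at least `d / 2`;
otherwise the left side is nonpositive. -/
lemma rpow_half_sub_le {d : ℝ} (hR : 0 ≤ R) (hp : 1 ≤ p) (hd : R ≤ d) :
    d ^ p / 2 - (2 * R) ^ p ≤ (d - R) * d ^ (p - 1) := by
  have hd0 : 0 ≤ d := hR.trans hd
  have h0 : 0 ≤ d ^ (p - 1) := Real.rpow_nonneg hd0 _
  have h1 : 0 ≤ (2 * R) ^ p := by positivity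
  rcases le_total (2 * R) d with h | h
  · have h2 : d ^ p = d * d ^ (p - 1) := by
      rw [← Real.rpow_one_add' hd0 (by linarith)]; congr 1; ring
    nlinarith
  · have h2 : d ^ p ≤ (2 * R) ^ p := Real.rpow_le_rpow hd0 h (by linarith)
    have h3 : 0 ≤ d ^ p := by positivity
    have h4 := mul_nonneg (sub_nonneg.2 hd) h0
    linarith

/-- Integration by parts with `H = G(f) (x - a)`, `a = x₀ + R`. The term `H V'` yields `(c / 2) G d
^ p` up to a multiple of `G`; the Young term takes back half, leaving `c / 4`. -/
lemma HasPowerGrowth.setIntegral_cutoff_Ioi (h : HasPowerGrowth V x₀ R c M p) (hq : 1 < q)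
    {m K : ℝ} (hm : 0 < m) (hK : 0 ≤ K) {f : ℝ → ℝ} (hf : Differentiable ℝ f)
    (hf' : Continuous (deriv f))
    (hle : ∀ x d, 1 ≤ d → |cutoffDeriv q m (f x) * deriv f x| * d ≤
        K * energyDensity q f x + c / 4 * (cutoff q m (f x) * d ^ p))
    (he : Integrable (energyDensity q f) (expMeasure V))
    (hG : Integrable (fun x => cutoff q m (f x)) (expMeasure V)) :
    IntegrableOn (fun x => cutoff q m (f x) * |x - x₀| ^ p) (Ioi (x₀ + R)) (expMeasure V) ∧
    ∫ x in Ioi (x₀ + R), cutoff q m (f x) * |x - x₀| ^ p ∂(expMeasure V) ≤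
      4 / c * (K * ∫ x, energyDensity q f x ∂(expMeasure V) +
        (1 + c * (2 * R) ^ p) * ∫ x, cutoff q m (f x) ∂(expMeasure V)) := by
  obtain ⟨v, hv, hvc, hvl⟩ := h.right_tail.exists_deriv
  have hc := h.c_pos
  have hR : 0 ≤ R := by linarith [h.one_le_R]
  have hB : 0 ≤ 1 + c * (2 * R) ^ p := by positivity
  have hGd : ∀ x, HasDerivAt (fun x => cutoff q m (f x)) (cutoffDeriv q m (f x) * deriv f x) x :=
    fun x => (hasDerivAt_cutoff hq hm (f x)).comp x (hf x).hasDerivAt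
  have hG0 : ∀ x, 0 ≤ cutoff q m (f x) := fun x => cutoff_nonneg _ _ _
  have hGc : Continuous (fun x => cutoff q m (f x)) :=
    continuous_iff_continuousAt.2 fun x => (hGd x).continuousAt
  have hG'c : Continuous fun x => cutoffDeriv q m (f x) * deriv f x :=
    ((continuous_cutoffDeriv hq hm).comp hf.continuous).mul hf'
  have he0 := energyDensity_nonneg q f
  have hQ0 : ∀ x, 0 ≤ K * energyDensity q f x + (1 + c * (2 * R) ^ p) * cutoff q m (f x) :=
    fun x => add_nonneg (mul_nonneg hK (he0 x)) (mul_nonneg hB (hG0 x))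
  have hQi : Integrable (fun x => K * energyDensity q f x +
      (1 + c * (2 * R) ^ p) * cutoff q m (f x)) (expMeasure V) :=
    (he.const_mul _).add (hG.const_mul _)
  obtain ⟨h1, h2⟩ := setIntegral_Ioi_le_of_deriv_sub_le (V := V) (v := v) (a := x₀ + R)
    (H := fun x => cutoff q m (f x) * (x - (x₀ + R)))
    (H' := fun x => cutoffDeriv q m (f x) * deriv f x * (x - (x₀ + R)) + cutoff q m (f x))
    (Q := fun x => K * energyDensity q f x + (1 + c * (2 * R) ^ p) * cutoff q m (f x))
    (W := fun x => c / 4 * (cutoff q m (f x) * |x - x₀| ^ p))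
    h.aemeasurable hv hvc
    (fun x => ((hGd x).mul ((hasDerivAt_id' x).sub_const _)).congr_deriv (by ring))
    (by fun_prop) (by simp) (fun x hx => mul_nonneg (hG0 x) (by linarith))
    (continuous_const.mul (hGc.mul ((by fun_prop : Continuous fun x => |x - x₀|).rpow_const
      fun _ => Or.inr (by linarith [h.one_le_p])))).continuousOn
    (fun x _ => mul_nonneg (by positivity) (mul_nonneg (hG0 x) (by positivity)))
    (fun x _ => hQ0 x) hQi.integrableOn
    (fun x hx => by
      have hd : R ≤ x - x₀ := by linarith
      have hd1 : 1 ≤ x - x₀ := h.one_le_R.trans hd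
      rw [abs_of_nonneg (by linarith : 0 ≤ x - x₀)]
      have e1 := hle x (x - x₀) hd1
      have e2 := mul_le_mul_of_nonneg_left (rpow_half_sub_le hR h.one_le_p hd) hc.le
      have e3 : cutoffDeriv q m (f x) * deriv f x * (x - (x₀ + R)) ≤
          |cutoffDeriv q m (f x) * deriv f x| * (x - x₀) :=
        mul_le_mul (le_abs_self _) (by linarith) (by linarith) (abs_nonneg _)
      have e4 := mul_le_mul_of_nonneg_left (hvl x hx)
        (mul_nonneg (hG0 x) (by linarith : 0 ≤ x - (x₀ + R)))
      have e5 := mul_le_mul_of_nonneg_left e2 (hG0 x)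
      have e6 : cutoff q m (f x) * (x - (x₀ + R)) * (c * (x - x₀) ^ (p - 1)) =
        cutoff q m (f x) * (c * ((x - x₀ - R) * (x - x₀) ^ (p - 1))) := by ring
      rw [e6] at e4
      linarith)
  have h1' : IntegrableOn (fun x => cutoff q m (f x) * |x - x₀| ^ p) (Ioi (x₀ + R))
      (expMeasure V) := by
    refine (h1.const_mul (4 / c)).congr (ae_of_all _ fun x => ?_)
    simp only []
    field_simp
  refine ⟨h1', ?_⟩
  have h3 := h2.trans (setIntegral_le_integral hQi (ae_of_all _ hQ0))
  rw [integral_const_mul, integral_add (he.const_mul _) (hG.const_mul _), integral_const_mul,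
    integral_const_mul] at h3
  have h4 := mul_le_mul_of_nonneg_left h3 (by positivity : 0 ≤ 4 / c)
  refine le_trans (le_of_eq ?_) h4
  field_simp

lemma energyDensity_comp_neg (q : ℝ) (f : ℝ → ℝ) (x : ℝ) :
    energyDensity q (fun x => f (-x)) x = energyDensity q f (-x) := by
  simp [energyDensity, deriv_comp_neg]

/-- The `U`-bound: the cutoff of `f ^ 2` integrates `|x - x₀| ^ p`. -/
lemma HasPowerGrowth.integral_cutoff_mul_rpow (h : HasPowerGrowth V x₀ R c M p) (hq : 2 < q)
    (hp : q / (q - 1) ≤ p) :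
    ∃ C : ℝ, 0 ≤ C ∧ ∀ (m : ℝ) (f : ℝ → ℝ), 0 < m → Differentiable ℝ f → Continuous (deriv f) →
      Integrable (energyDensity q f) (expMeasure V) →
      Integrable (fun x => cutoff q m (f x)) (expMeasure V) →
      Integrable (fun x => cutoff q m (f x) * |x - x₀| ^ p) (expMeasure V) ∧
      ∫ x, cutoff q m (f x) * |x - x₀| ^ p ∂(expMeasure V) ≤
        C * (∫ x, energyDensity q f x ∂(expMeasure V) +
          ∫ x, cutoff q m (f x) ∂(expMeasure V)) := by
  have hc := h.c_pos
  have hR : 0 ≤ R := by linarith [h.one_le_R]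
  obtain ⟨K, hK, hle⟩ := abs_cutoffDeriv_mul_le hq hp (by positivity : 0 < c / 4)
  have hC : 0 ≤ 4 / c * (K + (1 + c * (2 * R) ^ p)) + 4 / c * (K + (1 + c * (2 * R) ^ p)) + R ^ p := by
    positivity
  refine ⟨_, hC, fun m f hm hf hf' he hG => ?_⟩
  have hderiv : deriv (fun x => f (-x)) = fun x => -deriv f (-x) :=
    funext fun x => deriv_comp_neg f x
  have he' : Integrable (energyDensity q fun x => f (-x)) (expMeasure fun x => V (-x)) := by
    rw [funext (energyDensity_comp_neg q f)]
    exact integrable_comp_neg_expMeasure he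
  have hG' : Integrable (fun x => cutoff q m (f (-x))) (expMeasure fun x => V (-x)) :=
    integrable_comp_neg_expMeasure (F := fun x => cutoff q m (f x)) hG
  have hf'' : Continuous (deriv fun x => f (-x)) := by rw [hderiv]; fun_prop
  have hleft := h.reflect.setIntegral_cutoff_Ioi (by linarith : 1 < q) hm hK
    (f := fun x => f (-x)) (hf.comp differentiable_neg) hf''
    (fun x d hd => hle m (fun x => f (-x)) x d hm hd) he' hG'
  simp only [energyDensity_comp_neg] at hleft
  have habs : ∀ x : ℝ, |x - -x₀| = |-x - x₀| := fun x => by rw [← abs_neg]; congr 1; ring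
  simp only [habs] at hleft
  rw [integrableOn_Ioi_comp_neg_expMeasure (F := fun x => cutoff q m (f x) * |x - x₀| ^ p),
    setIntegral_Ioi_comp_neg_expMeasure V (fun x => cutoff q m (f x) * |x - x₀| ^ p),
    integral_comp_neg_expMeasure (energyDensity q f),
    integral_comp_neg_expMeasure (fun x => cutoff q m (f x)),
    show -(-x₀ + R) = x₀ - R by ring] at hleft
  have hright := h.setIntegral_cutoff_Ioi (by linarith : 1 < q) hm hK hf hf'
    (fun x d hd => hle m f x d hm hd) he hG
  have hG0 : ∀ x, 0 ≤ cutoff q m (f x) := fun x => cutoff_nonneg _ _ _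
  have hGI : 0 ≤ ∫ x, cutoff q m (f x) ∂(expMeasure V) := integral_nonneg hG0
  have hE : 0 ≤ ∫ x, energyDensity q f x ∂(expMeasure V) :=
    integral_nonneg (energyDensity_nonneg q f)
  set E := ∫ x, energyDensity q f x ∂(expMeasure V)
  set I := ∫ x, cutoff q m (f x) ∂(expMeasure V)
  have hpt : ∀ x ∈ Icc (x₀ - R) (x₀ + R),
      cutoff q m (f x) * |x - x₀| ^ p ≤ R ^ p * cutoff q m (f x) := fun x hx => by
    rw [mul_comm]
    exact mul_le_mul_of_nonneg_right (Real.rpow_le_rpow (abs_nonneg _)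
      (abs_le.2 ⟨by linarith [hx.1], by linarith [hx.2]⟩) (by linarith [h.one_le_p])) (hG0 x)
  have hmid : IntegrableOn (fun x => cutoff q m (f x) * |x - x₀| ^ p) (Icc (x₀ - R) (x₀ + R))
      (expMeasure V) := by
    have hpow : Measurable fun x : ℝ => |x - x₀| ^ p := by
      have : Measurable fun x : ℝ => |x - x₀| := by fun_prop
      exact this.pow_const p
    have hmeas : AEStronglyMeasurable (fun x => cutoff q m (f x) * |x - x₀| ^ p)
      (expMeasure V) := hG.1.mul hpow.aestronglyMeasurable
    have hdom : Integrable (fun x => R ^ p * cutoff q m (f x))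
      ((expMeasure V).restrict (Icc (x₀ - R) (x₀ + R))) := hG.restrict.const_mul (R ^ p)
    refine hdom.mono' hmeas.restrict ?_
    filter_upwards [ae_restrict_mem measurableSet_Icc] with x hx
    rw [Real.norm_of_nonneg (mul_nonneg (hG0 x) (by positivity))]
    exact hpt x hx
  obtain ⟨hint, hbd⟩ := integral_le_of_tails (by linarith) hright hleft ⟨hmid,
    (setIntegral_mono_on hmid (hG.integrableOn.const_mul (R ^ p)) measurableSet_Icc hpt).trans
      (le_of_eq (integral_const_mul _ _))⟩
  refine ⟨hint, ?_⟩
  refine hbd.trans ?_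
  have hmidI : ∫ x in Icc (x₀ - R) (x₀ + R), cutoff q m (f x) ∂(expMeasure V) ≤ I :=
    setIntegral_le_integral hG (ae_of_all _ hG0)
  have hs : 4 / c * (K * E + (1 + c * (2 * R) ^ p) * I) ≤
      4 / c * (K + (1 + c * (2 * R) ^ p)) * (E + I) := by
    have e1 : 0 ≤ 4 / c * (K * I + (1 + c * (2 * R) ^ p) * E) := by positivity
    linarith
  have ht : R ^ p * ∫ x in Icc (x₀ - R) (x₀ + R), cutoff q m (f x) ∂(expMeasure V) ≤
      R ^ p * (E + I) := mul_le_mul_of_nonneg_left (by linarith) (by positivity)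
  linarith

end Growth

/-! ### Pointwise entropy estimates and the modified log-Sobolev inequality -/

/-- The energy density is `0` at zeros of `f`, but a zero with `f' ≠ 0` is isolated, and such zeros
form a countable set. -/
lemma sq_deriv_le_energyDensity_ae {q : ℝ} (hq : 2 ≤ q) {f : ℝ → ℝ} (hf : Differentiable ℝ f) :
    ∀ᵐ x ∂(volume : Measure ℝ), deriv f x ^ 2 ≤ energyDensity q f x := by
  have hcount : {x ∈ {x | f x = 0} | 𝓝[{x | f x = 0} ∩ Ioi x] x = ⊥}.Countable :=
    countable_setOfPred_isolated_right_within
  filter_upwards [hcount.ae_notMem volume] with x hx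
  rcases eq_or_ne (f x) 0 with h0 | h0
  · have hd : deriv f x = 0 := by
      by_contra hd
      refine hx ⟨h0, ?_⟩
      have hne := (hf x).hasDerivAt.eventually_ne (c := 0) hd
      rw [← empty_mem_iff_bot]
      have h1 : {z | f z ≠ 0} ∈ 𝓝[{x | f x = 0} ∩ Ioi x] x :=
        nhdsWithin_mono x (fun z hz => (ne_of_gt hz.2 : z ≠ x)) hne
      filter_upwards [h1, self_mem_nhdsWithin] with z hz hz'
      exact hz hz'.1
    rw [hd]
    simpa using energyDensity_nonneg q f x
  · have := mul_le_mul_of_nonneg_right (sq_le_modH hq (|deriv f x| / f x)) (sq_nonneg (f x))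
    rwa [div_pow, sq_abs, div_mul_cancel₀ _ (pow_ne_zero 2 h0)] at this

lemma absolutelyContinuous_expMeasure (V : ℝ → ℝ) : expMeasure V ≪ volume :=
  withDensity_absolutelyContinuous _ _

/-- The entropy integrand `t² log (t² / m²) - t² + m²` is at most quadratic near `|t| = m`. -/
lemma sq_mul_log_sub_le {m t : ℝ} (hm : 0 < m) :
    t ^ 2 * Real.log (t ^ 2 / m ^ 2) - t ^ 2 + m ^ 2 ≤ (2 * (|t| / m) + 1) * (|t| - m) ^ 2 := by
  have hs : 0 ≤ |t| / m := by positivity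
  have ht : t ^ 2 = m ^ 2 * (|t| / m) ^ 2 := by rw [div_pow, sq_abs]; field_simp
  have ht' : |t| - m = m * (|t| / m - 1) := by field_simp
  rw [ht, ht', mul_div_cancel_left₀ _ (by positivity), Real.log_pow]
  generalize |t| / m = s at hs
  have hm2 : 0 ≤ m ^ 2 := sq_nonneg m
  rcases hs.eq_or_lt with h | h
  · rw [← h]; norm_num
  · have hl := mul_le_mul_of_nonneg_left (Real.log_le_sub_one_of_pos h)
      (by positivity : 0 ≤ m ^ 2 * s ^ 2)
    push_cast
    linarith

lemma sq_mul_log_sub_nonneg {m t : ℝ} (hm : 0 < m) :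
    0 ≤ t ^ 2 * Real.log (t ^ 2 / m ^ 2) - t ^ 2 + m ^ 2 := by
  have h : t ^ 2 = m ^ 2 * (t ^ 2 / m ^ 2) := by field_simp
  have hs : 0 ≤ t ^ 2 / m ^ 2 := by positivity
  have hl := mul_le_mul_of_nonneg_left (Real.self_sub_one_le_mul_log hs) (sq_nonneg m)
  rw [mul_sub, ← mul_assoc, ← h] at hl
  linarith

/-- The `L²` distance of `|f|` to the constant `‖f‖₂` is controlled by the distance of `f` to any
constant. -/
lemma integral_sq_abs_sub_le {μ : Measure ℝ} [IsProbabilityMeasure μ] {f : ℝ → ℝ} {m a : ℝ}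
    (hm : 0 < m) (hfm : AEStronglyMeasurable f μ) (hf : Integrable (fun x => f x ^ 2) μ)
    (hmf : ∫ x, f x ^ 2 ∂μ = m ^ 2) :
    Integrable (fun x => (|f x| - m) ^ 2) μ ∧
      ∫ x, (|f x| - m) ^ 2 ∂μ ≤ 2 * ∫ x, (f x - a) ^ 2 ∂μ := by
  have hf2 : MemLp f 2 μ := (memLp_two_iff_integrable_sq hfm).2 hf
  have habs : Integrable (fun x => |f x|) μ := (hf2.integrable one_le_two).abs
  have hdec : ∀ b x : ℝ, (|f x| - b) ^ 2 = f x ^ 2 - 2 * b * |f x| + b ^ 2 := fun b x => by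
    rw [sub_sq, sq_abs]; ring
  have hint : ∀ b, Integrable (fun x => (|f x| - b) ^ 2) μ := fun b => by
    simp_rw [hdec]
    exact (hf.sub (habs.const_mul _)).add (integrable_const _)
  have hval : ∀ b, ∫ x, (|f x| - b) ^ 2 ∂μ = m ^ 2 - 2 * b * ∫ x, |f x| ∂μ + b ^ 2 := fun b => by
    have hlin : Integrable (fun x => f x ^ 2 - 2 * b * |f x|) μ := hf.sub (habs.const_mul _)
    simp_rw [hdec]
    rw [integral_add hlin (integrable_const _),
      integral_sub hf (habs.const_mul _), integral_const_mul, hmf]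
    simp
  have hshift : Integrable (fun x => (f x - a) ^ 2) μ :=
    (hf2.sub (memLp_const a)).integrable_sq
  have hS : ∫ x, (|f x| - |a|) ^ 2 ∂μ ≤ ∫ x, (f x - a) ^ 2 ∂μ :=
    integral_mono (hint _) hshift fun x => sq_le_sq.2 (abs_abs_sub_abs_le (f x) a)
  refine ⟨hint m, ?_⟩
  have hA0 : 0 ≤ ∫ x, |f x| ∂μ := integral_nonneg fun x => abs_nonneg _
  have hvar : 0 ≤ ∫ x, (|f x| - ∫ x, |f x| ∂μ) ^ 2 ∂μ := integral_nonneg fun x => sq_nonneg _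
  rw [hval] at hvar hS ⊢
  set A := ∫ x, |f x| ∂μ
  have hAm : A ≤ m := by nlinarith
  -- With `0 ≤ A ≤ m`: `2m² - 2mA ≤ 2 (m² - A²) ≤ 2 (m² - 2|a|A + a²)`.
  nlinarith [sq_nonneg (A - |a|)]

/-- Pointwise bound of the entropy integrand by the quantities controlled by the energy. -/
lemma entropy_le_cutoff {q m t L : ℝ} (hq : 0 < q) (hm : 0 < m) (hL0 : 0 ≤ L)
    (hL : Real.log (t ^ 2 / m ^ 2) ≤ L) :
    t ^ 2 * Real.log (t ^ 2 / m ^ 2) - t ^ 2 + m ^ 2 ≤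
      9 * (|t| - m) ^ 2 + 2 ^ q * (cutoff q m t * L) := by
  have hG := cutoff_nonneg q m t
  have h2 : (0 : ℝ) < 2 ^ q := by positivity
  -- Below `4m` the factor `2 |t| / m + 1` is at most `9`; above it the cutoff is comparable to
  -- `t²`.
  rcases le_total |t| (4 * m) with h | h
  · refine (sq_mul_log_sub_le hm).trans (le_add_of_le_of_nonneg ?_ (by positivity))
    refine mul_le_mul_of_nonneg_right ?_ (sq_nonneg _)
    have : |t| / m ≤ 4 := (div_le_iff₀ hm).2 h
    linarith
  · have h1 := le_cutoff hq hm h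
    have h3 : m ^ 2 ≤ t ^ 2 := by rw [← sq_abs t]; nlinarith
    have h4 := mul_le_mul_of_nonneg_left hL (sq_nonneg t)
    have h5 := mul_le_mul_of_nonneg_right h1 hL0
    have h6 := sq_nonneg (|t| - m)
    linarith

/-- Logarithmic growth of functions of finite energy. -/
lemma log_sq_div_le {M C D m s a d p t : ℝ} (hC : 0 ≤ C) (hD : 0 ≤ D) (hM : 0 ≤ M)
    (hm : 0 < m) (hd : 0 ≤ d) (hp : 1 ≤ p)
    (ha : a ^ 2 ≤ 2 * m ^ 2 + 2 * (C * D))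
    (hta : (t - a) ^ 2 ≤ d * Real.exp (M * (1 + d ^ p)) * D) (hs : s = Real.log (6 + 4 * C) + M + 1) :
    Real.log (t ^ 2 / m ^ 2) ≤ s + (M + 1) * d ^ p + D / m ^ 2 := by
  have hm2 : 0 < m ^ 2 := by positivity
  have hdp : 0 ≤ d ^ p := by positivity
  have hlog0 : 0 ≤ Real.log (6 + 4 * C) := Real.log_nonneg (by linarith)
  have hrhs : 0 ≤ s + (M + 1) * d ^ p + D / m ^ 2 := by rw [hs]; positivity
  rcases eq_or_ne t 0 with rfl | ht
  · simpa using hrhs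
  have hd1 : d ≤ 1 + d ^ p := by
    rcases le_total d 1 with h | h
    · linarith
    · have := Real.rpow_le_rpow_of_exponent_le h hp
      rw [Real.rpow_one] at this
      linarith
  have hde : d ≤ Real.exp (1 + d ^ p) := by linarith [Real.add_one_le_exp (1 + d ^ p)]
  have hX : d * Real.exp (M * (1 + d ^ p)) ≤ Real.exp ((M + 1) * (1 + d ^ p)) := by
    rw [show (M + 1) * (1 + d ^ p) = (1 + d ^ p) + M * (1 + d ^ p) by ring, Real.exp_add]
    exact mul_le_mul_of_nonneg_right hde (Real.exp_pos _).le
  have hX1 : 1 ≤ Real.exp ((M + 1) * (1 + d ^ p)) := Real.one_le_exp (by positivity)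
  set X := Real.exp ((M + 1) * (1 + d ^ p)) with hXdef
  have h1 : t ^ 2 ≤ 2 * (X * D) + 4 * m ^ 2 + 4 * (C * D) := by
    have := hta.trans (mul_le_mul_of_nonneg_right hX hD)
    nlinarith [sq_nonneg (t - a - a)]
  have hCD : 0 ≤ C * D := mul_nonneg hC hD
  have h2 : t ^ 2 / m ^ 2 ≤ (6 + 4 * C) * X * (1 + D / m ^ 2) := by
    -- A product bound is sought so that the logarithm splits into a sum.
    rw [div_le_iff₀ hm2, mul_assoc _ (1 + D / m ^ 2), add_mul 1, one_mul,
      div_mul_cancel₀ _ hm2.ne']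
    have e1 : m ^ 2 ≤ X * m ^ 2 := le_mul_of_one_le_left hm2.le hX1
    have e2 : C * D ≤ X * (C * D) := le_mul_of_one_le_left hCD hX1
    have e3 : 0 ≤ X * D := by positivity
    have e4 : 0 ≤ C * (X * m ^ 2) := by positivity
    linarith
  have hDm : 0 ≤ D / m ^ 2 := by positivity
  calc Real.log (t ^ 2 / m ^ 2) ≤ Real.log ((6 + 4 * C) * X * (1 + D / m ^ 2)) :=
        Real.log_le_log (by positivity) h2
    _ = Real.log (6 + 4 * C) + (M + 1) * (1 + d ^ p) + Real.log (1 + D / m ^ 2) := by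
        rw [Real.log_mul (by positivity) (by positivity), Real.log_mul (by positivity)
          (by positivity), hXdef, Real.log_exp]
    _ ≤ _ := by
        have := Real.log_le_sub_one_of_pos (by positivity : 0 < 1 + D / m ^ 2)
        rw [hs]; linarith

/-- Measures with potential of power growth of order `p ≥ q / (q - 1)` satisfy the modified
log-Sobolev inequality for `H_q`. -/
theorem HasPowerGrowth.satisfiesMLS {V : ℝ → ℝ} {x₀ R c M p q : ℝ}
    (h : HasPowerGrowth V x₀ R c M p) (hq : 2 < q) (hp : q / (q - 1) ≤ p)
    [IsProbabilityMeasure (expMeasure V)] : SatisfiesMLS q (expMeasure V) := by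
  obtain ⟨CP, hCP, hpoinc⟩ := h.poincare
  obtain ⟨CU, hCU, hU⟩ := h.integral_cutoff_mul_rpow hq hp
  have hM := h.M_nonneg
  have hq0 : 0 < q := by linarith
  set μ := expMeasure V with hμ
  set s := Real.log (6 + 4 * CP) + M + 1 with hs
  have hs0 : 0 ≤ s := by
    have : 0 ≤ Real.log (6 + 4 * CP) := Real.log_nonneg (by linarith)
    positivity
  refine ⟨9 * (2 * CP) + 2 ^ q * (s * (16 * CP) + (M + 1) * (CU * (1 + 16 * CP)) + 2) + 1,
    by positivity, fun f hf he => ?_⟩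
  have hfd : Differentiable ℝ f := hf.differentiable (by simp)
  have hfc : Continuous f := hfd.continuous
  have hf' : Continuous (deriv f) := hf.continuous_deriv (by simp)
  have hE0 : 0 ≤ ∫ x, energyDensity q f x ∂μ := integral_nonneg (energyDensity_nonneg q f)
  have hae : ∀ᵐ x ∂μ, deriv f x ^ 2 ≤ energyDensity q f x :=
    (absolutelyContinuous_expMeasure V).ae_le (sq_deriv_le_energyDensity_ae hq.le hfd)
  have hD : Integrable (fun x => deriv f x ^ 2) μ := by
    refine he.mono' (by fun_prop) (hae.mono fun x hx => ?_)
    rwa [Real.norm_of_nonneg (sq_nonneg _)]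
  have hDE := integral_mono_ae hD he hae
  have hD0 : 0 ≤ ∫ x, deriv f x ^ 2 ∂μ := integral_nonneg fun x => sq_nonneg _
  obtain ⟨hPi, hPb⟩ := hpoinc f (deriv f) (fun x => (hfd x).hasDerivAt) hf' hD
  have hosc := h.sq_sub_le (fun x => (hfd x).hasDerivAt) hf' hD
  rw [← hμ] at hosc
  have hf2 : Integrable (fun x => f x ^ 2) μ := by
    refine ((hPi.const_mul 2).add (integrable_const (2 * f x₀ ^ 2))).mono' (by fun_prop)
      (ae_of_all _ fun x => ?_)
    rw [Real.norm_of_nonneg (sq_nonneg _)]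
    simp only [Pi.add_apply]
    nlinarith [sq_nonneg (f x - f x₀ - f x₀)]
  refine ⟨hf2, ?_⟩
  rcases (integral_nonneg fun x => sq_nonneg (f x) : 0 ≤ ∫ x, f x ^ 2 ∂μ).eq_or_lt with h0 | h0
  -- Division by zero gives `log 0 = 0`, so the density vanishes identically.
  · have : entropyDensity μ f = fun _ => 0 := funext fun x => by
      rw [entropyDensity, ← h0]; simp
    rw [this]
    refine ⟨integrable_zero _ _ _, ?_⟩
    rw [integral_zero]
    positivity
  obtain ⟨m, hm, hmm⟩ : ∃ m : ℝ, 0 < m ∧ ∫ x, f x ^ 2 ∂μ = m ^ 2 :=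
    ⟨√(∫ x, f x ^ 2 ∂μ), Real.sqrt_pos.2 h0, (Real.sq_sqrt h0.le).symm⟩
  set E := ∫ x, energyDensity q f x ∂μ
  set D := ∫ x, deriv f x ^ 2 ∂μ
  have hm2 : 0 < m ^ 2 := by positivity
  obtain ⟨hAi, hAb⟩ := integral_sq_abs_sub_le (a := f x₀) hm
    hfc.aestronglyMeasurable hf2 hmm
  have hAE : ∫ x, (|f x| - m) ^ 2 ∂μ ≤ 2 * CP * E := by
    have := mul_le_mul_of_nonneg_left hDE hCP
    linarith
  have hG0 : ∀ x, 0 ≤ cutoff q m (f x) := fun x => cutoff_nonneg _ _ _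
  have hGc : Continuous (fun x => cutoff q m (f x)) :=
    continuous_iff_continuousAt.2 fun x =>
      (hasDerivAt_cutoff (by linarith) hm (f x)).continuousAt.comp hfc.continuousAt
  have hGi : Integrable (fun x => cutoff q m (f x)) μ := by
    refine (hf2.const_mul 2).mono' hGc.aestronglyMeasurable (ae_of_all _ fun x => ?_)
    rw [Real.norm_of_nonneg (hG0 x)]
    exact cutoff_le hq0 hm _
  have hGE : ∫ x, cutoff q m (f x) ∂μ ≤ 16 * CP * E := by
    have := integral_mono hGi (hAi.const_mul 8) fun x => cutoff_le_sq_sub hq0 hm (f x)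
    rw [integral_const_mul] at this
    linarith
  have hGm : ∫ x, cutoff q m (f x) ∂μ ≤ 2 * m ^ 2 := by
    have := integral_mono hGi (hf2.const_mul 2) fun x => cutoff_le hq0 hm (f x)
    rwa [integral_const_mul, hmm] at this
  obtain ⟨hGdi, hGdb⟩ := hU m f hm hfd hf' he hGi
  -- Average `f x₀ = f x - (f x - f x₀)` over `μ`, which has mass one.
  have hfx₀ : f x₀ ^ 2 ≤ 2 * m ^ 2 + 2 * (CP * D) := by
    have h1 : ∫ _ : ℝ, f x₀ ^ 2 ∂μ ≤ ∫ x, (2 * f x ^ 2 + 2 * (f x - f x₀) ^ 2) ∂μ :=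
      integral_mono (integrable_const _) ((hf2.const_mul 2).add (hPi.const_mul 2)) fun x => by
        simp only []
        nlinarith [sq_nonneg (f x + (f x - f x₀))]
    rw [integral_add (hf2.const_mul 2) (hPi.const_mul 2), integral_const_mul,
      integral_const_mul, hmm] at h1
    simp only [integral_const, probReal_univ, one_smul] at h1
    linarith
  set B : ℝ → ℝ := fun x => 9 * (|f x| - m) ^ 2 + 2 ^ q * ((s + D / m ^ 2) * cutoff q m (f x) +
    (M + 1) * (cutoff q m (f x) * |x - x₀| ^ p)) with hB
  have hB1 : Integrable (fun x => (s + D / m ^ 2) * cutoff q m (f x) +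
    (M + 1) * (cutoff q m (f x) * |x - x₀| ^ p)) μ := (hGi.const_mul _).add (hGdi.const_mul _)
  have hBi : Integrable B μ := (hAi.const_mul 9).add (hB1.const_mul _)
  have hηB : ∀ x, entropyDensity μ f x - f x ^ 2 + m ^ 2 ≤ B x := fun x => by
    have hlog := log_sq_div_le (s := s) hCP hD0 hM hm (abs_nonneg (x - x₀)) h.one_le_p hfx₀
      (hosc x) hs
    have := entropy_le_cutoff hq0 hm (by positivity) hlog
    rw [entropyDensity, hmm]
    refine this.trans (le_of_eq ?_)
    rw [hB]
    ring
  -- Nonnegativity turns the upper bound by `B` into integrability of the entropy.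
  have hη0 : ∀ x, 0 ≤ entropyDensity μ f x - f x ^ 2 + m ^ 2 := fun x => by
    rw [entropyDensity, hmm]
    exact sq_mul_log_sub_nonneg hm
  have hmeas : Measurable (entropyDensity μ f) := by
    unfold entropyDensity
    have : Measurable f := hfc.measurable
    fun_prop
  have hηi : Integrable (fun x => entropyDensity μ f x - f x ^ 2 + m ^ 2) μ := by
    refine hBi.mono' ?_ (ae_of_all _ fun x => ?_)
    · exact ((hmeas.sub (hfc.measurable.pow_const 2)).add_const _).aestronglyMeasurable
    · rw [Real.norm_of_nonneg (hη0 x)]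
      exact hηB x
  have heq : ∀ x, entropyDensity μ f x =
      (entropyDensity μ f x - f x ^ 2 + m ^ 2) + (f x ^ 2 - m ^ 2) := fun x => by ring
  have hfm : Integrable (fun x => f x ^ 2 - m ^ 2) μ := hf2.sub (integrable_const _)
  refine ⟨(hηi.add hfm).congr (ae_of_all _ fun x => (heq x).symm), ?_⟩
  have hI : ∫ x, entropyDensity μ f x ∂μ =
      ∫ x, (entropyDensity μ f x - f x ^ 2 + m ^ 2) ∂μ := by
    rw [integral_congr_ae (ae_of_all _ heq), integral_add hηi hfm,
      integral_sub hf2 (integrable_const _), hmm]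
    simp
  rw [hI]
  refine (integral_mono hηi hBi hηB).trans ?_
  rw [hB, integral_add (hAi.const_mul 9) (hB1.const_mul _), integral_const_mul,
    integral_const_mul, integral_add (hGi.const_mul _) (hGdi.const_mul _), integral_const_mul,
    integral_const_mul]
  have hGIpos : 0 ≤ ∫ x, cutoff q m (f x) ∂μ := integral_nonneg hG0
  set I := ∫ x, cutoff q m (f x) ∂μ
  have e1 : s * I ≤ s * (16 * CP * E) := mul_le_mul_of_nonneg_left hGE hs0
  -- This coefficient depends on `f`; the cruder bound `I ≤ 2m²` cancels `m²`, whereas `I ≤ 16 CP E`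
  -- would give a term quadratic in the energy.
  have e2 : D / m ^ 2 * I ≤ 2 * E := by
    have := mul_le_mul_of_nonneg_left hGm (by positivity : 0 ≤ D / m ^ 2)
    have e : D / m ^ 2 * (2 * m ^ 2) = 2 * D := by field_simp
    linarith
  have e3 : (M + 1) * ∫ x, cutoff q m (f x) * |x - x₀| ^ p ∂μ ≤
      (M + 1) * (CU * (E + 16 * CP * E)) := by
    refine mul_le_mul_of_nonneg_left (hGdb.trans ?_) (by positivity)
    exact mul_le_mul_of_nonneg_left (by linarith) hCU
  have e4 : (s + D / m ^ 2) * I + (M + 1) * ∫ x, cutoff q m (f x) * |x - x₀| ^ p ∂μ ≤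
      s * (16 * CP * E) + 2 * E + (M + 1) * (CU * (E + 16 * CP * E)) := by linarith
  have e5 := mul_le_mul_of_nonneg_left e4 (by positivity : (0 : ℝ) ≤ 2 ^ q)
  linarith

/-! ### The cosine perturbation: measurability, growth, failure of convexity -/

/-- `V` is continuous at each point of differentiability, hence continuous on a conull set.
Measurability of `α` on `[-1, 1]` is thus not needed. -/
lemma aemeasurable_of_ae_differentiableAt {V : ℝ → ℝ}
    (h : ∀ᵐ x ∂(volume : Measure ℝ), DifferentiableAt ℝ V x) : AEMeasurable V := by
  have hs : NullMeasurableSet {x | DifferentiableAt ℝ V x} (volume : Measure ℝ) := by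
    refine NullMeasurableSet.of_compl (NullMeasurableSet.of_null ?_)
    exact h
  have hc : ContinuousOn V {x | DifferentiableAt ℝ V x} :=
    fun x hx => (show DifferentiableAt ℝ V x from hx).continuousAt.continuousWithinAt
  have hr : (volume : Measure ℝ).restrict {x | DifferentiableAt ℝ V x} = volume :=
    Measure.restrict_eq_self_of_ae_mem (s := {x | DifferentiableAt ℝ V x}) h
  rw [← hr]
  exact hc.aemeasurable₀ hs

lemma integrable_exp_neg_mul_abs_sub {c : ℝ} (hc : 0 < c) (x₀ : ℝ) :
    Integrable fun x : ℝ => Real.exp (-c * |x - x₀|) := by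
  have h : Integrable fun x : ℝ => Real.exp (-c * |x|) := by
    rw [← integrableOn_univ, ← Iic_union_Ioi (a := (0 : ℝ))]
    refine IntegrableOn.union ?_ ?_
    · refine (integrableOn_exp_mul_Iic hc 0).congr_fun (fun x hx => ?_) measurableSet_Iic
      simp only [abs_of_nonpos (mem_Iic.1 hx)]
      ring_nf
    · refine (exp_neg_integrableOn_Ioi 0 hc).congr_fun (fun x hx => ?_) measurableSet_Ioi
      simp only [abs_of_pos (mem_Ioi.1 hx)]
  exact h.comp_sub_right x₀

/-- Outside `[-1, 1]`, `V` is the oscillating perturbation of `|x - x₀| ^ p`. -/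
def IsCosPerturbation (p k x₀ : ℝ) (V : ℝ → ℝ) : Prop :=
  ∀ x, 1 < |x| → V x = |x - x₀| ^ p + k * |x - x₀| ^ (p - 1) * Real.cos x

section

variable {p k x₀ : ℝ} {V : ℝ → ℝ}

lemma IsCosPerturbation.reflect (h : IsCosPerturbation p k x₀ V) :
    IsCosPerturbation p k (-x₀) fun x => V (-x) := fun x hx => by
  simp only [h (-x) (by rwa [abs_neg]), Real.cos_neg]
  rw [show -x - x₀ = -(x - -x₀) by ring, abs_neg]

lemma IsCosPerturbation.hasDerivAt (h : IsCosPerturbation p k x₀ V) {x : ℝ} (hx1 : 1 < x)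
    (hx : x₀ < x) :
    HasDerivAt V (p * (x - x₀) ^ (p - 1) + k * ((p - 1) * (x - x₀) ^ (p - 1 - 1) * Real.cos x -
      (x - x₀) ^ (p - 1) * Real.sin x)) x := by
  have hne : x - x₀ ≠ 0 := (sub_pos.2 hx).ne'
  have h1 : ∀ r : ℝ, HasDerivAt (fun x => (x - x₀) ^ r) (r * (x - x₀) ^ (r - 1)) x := fun r =>
    (((hasDerivAt_id' x).sub_const x₀).rpow_const (Or.inl hne)).congr_deriv (by ring)
  have h2 := (h1 p).fun_add (((h1 (p - 1)).fun_mul (Real.hasDerivAt_cos x)).const_mul k)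
  refine (h2.congr_deriv (by ring)).congr_of_eventuallyEq ?_
  filter_upwards [Ioi_mem_nhds hx1, Ioi_mem_nhds hx] with y hy1 hy
  rw [h y (lt_of_lt_of_le hy1 (le_abs_self y)), abs_of_pos (sub_pos.2 hy)]
  ring

/-- Beyond `x₀ + 2 + |x₀|` both `x > 1` and `d = x - x₀ ≥ 1`, so `d ^ (p - 2) ≤ d ^ (p - 1)` and the
perturbation lowers `V'` by at most `k ((p - 1) + 1) d ^ (p - 1)`. The shift `Z` will be the
logarithm of the normalising constant. -/
lemma IsCosPerturbation.hasRightTail (h : IsCosPerturbation p k x₀ V) (hp : 1 ≤ p) (hk : 0 ≤ k)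
    (Z : ℝ) : HasRightTail (fun x => V x + Z) x₀ (2 + |x₀|) (p * (1 - k)) p := by
  have hx : ∀ x, x₀ + (2 + |x₀|) ≤ x → 1 < x ∧ 1 ≤ x - x₀ := fun x hx =>
    ⟨by linarith [neg_abs_le x₀], by linarith [abs_nonneg x₀]⟩
  refine ⟨fun x => p * (x - x₀) ^ (p - 1) + k * ((p - 1) * (x - x₀) ^ (p - 1 - 1) * Real.cos x -
      (x - x₀) ^ (p - 1) * Real.sin x), fun x hx' => ?_, ?_, fun x hx' => ?_⟩
  · exact (h.hasDerivAt (hx x hx').1 (by linarith [(hx x hx').2])).add_const Z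
  · have h1 : ∀ r : ℝ, ContinuousOn (fun x : ℝ => (x - x₀) ^ r) (Ici (x₀ + (2 + |x₀|))) := fun r =>
      ContinuousOn.rpow_const (by fun_prop) fun x hx' => Or.inl
        (by linarith [(hx x hx').2] : 0 < x - x₀).ne'
    have h2 := h1 (p - 1)
    have h3 := h1 (p - 1 - 1)
    fun_prop
  · have hd := (hx x hx').2
    have h1 : (x - x₀) ^ (p - 1 - 1) ≤ (x - x₀) ^ (p - 1) :=
      Real.rpow_le_rpow_of_exponent_le hd (by linarith)
    have h2 : 0 ≤ (x - x₀) ^ (p - 1 - 1) := by positivity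
    have h3 : 0 ≤ (x - x₀) ^ (p - 1) := by positivity
    have hp1 : 0 ≤ p - 1 := by linarith
    have e1 : -((p - 1) * (x - x₀) ^ (p - 1)) ≤ (p - 1) * (x - x₀) ^ (p - 1 - 1) * Real.cos x := by
      have := mul_le_mul_of_nonneg_left (Real.neg_one_le_cos x) (mul_nonneg hp1 h2)
      have := mul_le_mul_of_nonneg_left h1 hp1
      linarith
    have e2 : (x - x₀) ^ (p - 1) * Real.sin x ≤ (x - x₀) ^ (p - 1) :=
      mul_le_of_le_one_right h3 (Real.sin_le_one x)
    have e3 := mul_le_mul_of_nonneg_left (sub_le_sub e1 e2) hk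
    linarith

lemma rpow_sub_one_le {d : ℝ} (hd : 0 ≤ d) (hp : 1 ≤ p) : d ^ (p - 1) ≤ 1 + d ^ p := by
  have h0 : 0 ≤ d ^ p := by positivity
  rcases le_total d 1 with h | h
  · linarith [Real.rpow_le_one hd h (by linarith : 0 ≤ p - 1)]
  · linarith [Real.rpow_le_rpow_of_exponent_le h (by linarith : p - 1 ≤ p)]

lemma IsCosPerturbation.abs_sub_le (h : IsCosPerturbation p k x₀ V) (hk : 0 ≤ k) {x : ℝ}
    (hx : 1 < |x|) : |V x - |x - x₀| ^ p| ≤ k * |x - x₀| ^ (p - 1) := by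
  rw [h x hx, add_sub_cancel_left, abs_mul, abs_of_nonneg (by positivity)]
  exact mul_le_of_le_one_right (by positivity) (Real.abs_cos_le_one x)

lemma IsCosPerturbation.exists_le (h : IsCosPerturbation p k x₀ V) (hp : 1 ≤ p) (hk : 0 ≤ k)
    (hb : ∃ B, ∀ x, |x| ≤ 1 → |V x| ≤ B) (Z : ℝ) :
    ∃ M, 0 ≤ M ∧ ∀ x, V x + Z ≤ M * (1 + |x - x₀| ^ p) := by
  obtain ⟨B, hB⟩ := hb
  have hB0 : 0 ≤ B := (abs_nonneg _).trans (hB 0 (by simp))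
  refine ⟨1 + k + B + |Z|, by positivity, fun x => ?_⟩
  have h0 : 0 ≤ |x - x₀| ^ p := by positivity
  have hZ := le_abs_self Z
  have e1 : 0 ≤ (B + |Z|) * |x - x₀| ^ p := by positivity
  have e2 : 0 ≤ (1 + k) * |x - x₀| ^ p := by positivity
  rcases le_or_gt |x| 1 with hx | hx
  · linarith [le_of_abs_le (hB x hx)]
  · have h1 := le_of_abs_le (h.abs_sub_le hk hx)
    have h2 := mul_le_mul_of_nonneg_left (rpow_sub_one_le (abs_nonneg (x - x₀)) hp) hk
    linarith

/-- For `d ≥ 1`, `d ^ p - k d ^ (p - 1) ≥ (1 - k) d ^ p ≥ (1 - k) d`. Linear growth suffices for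
integrability of `e^{-V}`. -/
lemma IsCosPerturbation.exists_ge (h : IsCosPerturbation p k x₀ V) (hp : 1 ≤ p) (hk : 0 ≤ k)
    (hk1 : k ≤ 1) (hb : ∃ B, ∀ x, |x| ≤ 1 → |V x| ≤ B) :
    ∃ M, ∀ x, (1 - k) * |x - x₀| - M ≤ V x := by
  obtain ⟨B, hB⟩ := hb
  have hB0 : 0 ≤ B := (abs_nonneg _).trans (hB 0 (by simp))
  refine ⟨2 + |x₀| + B, fun x => ?_⟩
  have hx₀ := abs_nonneg x₀
  have hd := abs_nonneg (x - x₀)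
  have hkd : 0 ≤ k * |x - x₀| := by positivity
  rcases le_or_gt |x| 1 with hx | hx
  · linarith [neg_le_of_abs_le (hB x hx), abs_sub x x₀]
  · have h1 := neg_le_of_abs_le (h.abs_sub_le hk hx)
    rcases le_total |x - x₀| 1 with h2 | h2
    · have e1 : k * |x - x₀| ^ (p - 1) ≤ 1 :=
        mul_le_one₀ hk1 (by positivity) (Real.rpow_le_one hd h2 (by linarith))
      have e2 : 0 ≤ |x - x₀| ^ p := by positivity
      linarith
    · have e1 : |x - x₀| ^ (p - 1) ≤ |x - x₀| ^ p :=
        Real.rpow_le_rpow_of_exponent_le h2 (by linarith)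
      have e2 : |x - x₀| ≤ |x - x₀| ^ p := by
        simpa using Real.rpow_le_rpow_of_exponent_le h2 hp
      have e3 := mul_le_mul_of_nonneg_left e1 hk
      have e4 := mul_le_mul_of_nonneg_left e2 (sub_nonneg.2 hk1)
      linarith

/-- At `a, b = 2πn ∓ π / 2` the cosine vanishes, and `V'` equals `(p + k) (a - x₀) ^ (p - 1)` and
`(p - k) (b - x₀) ^ (p - 1)`. Monotonicity of `V'` would keep `(b - x₀) / (a - x₀)` above a fixed `r
> 1`, yet this ratio tends to `1` as `n → ∞`. -/
lemma IsCosPerturbation.not_convexOn (h : IsCosPerturbation p k x₀ V) (hp : 1 < p) (hk : 0 < k)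
    (hkp : k < p) : ¬ ConvexOn ℝ univ V := by
  intro hconv
  have hπ := Real.pi_pos
  set r := ((p + k) / (p - k)) ^ (1 / (p - 1)) with hr
  have hr1 : 1 < r := Real.one_lt_rpow ((one_lt_div (by linarith)).2 (by linarith))
    (one_div_pos.2 (by linarith))
  have hrp : r ^ (p - 1) = (p + k) / (p - k) := by
    rw [hr, ← Real.rpow_mul (div_nonneg (by linarith) (by linarith)),
      one_div_mul_cancel (by linarith), Real.rpow_one]
  -- Large enough that `a > 1`, `a > x₀` and `(r - 1) (a - x₀) > π = b - a`.
  obtain ⟨n, hn⟩ := exists_nat_gt ((2 + |x₀| + Real.pi + Real.pi / (r - 1)) / (2 * Real.pi))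
  rw [div_lt_iff₀ (by positivity)] at hn
  have hq : 0 < Real.pi / (r - 1) := div_pos hπ (by linarith)
  have hx₀ := le_abs_self x₀
  have hx₀' := abs_nonneg x₀
  set a := n * (2 * Real.pi) - Real.pi / 2 with ha
  set b := n * (2 * Real.pi) + Real.pi / 2 with hb
  have hs0 : Real.sin (n * (2 * Real.pi)) = 0 := by
    simpa using Real.sin_add_nat_mul_two_pi 0 n
  have hca : Real.cos a = 0 := by
    rw [ha, Real.cos_sub_pi_div_two, hs0]
  have hcb : Real.cos b = 0 := by
    rw [hb, Real.cos_add_pi_div_two, hs0, neg_zero]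
  have hsa : Real.sin a = -1 := by
    rw [ha, Real.sin_sub_pi_div_two]; simp
  have hsb : Real.sin b = 1 := by
    rw [hb, Real.sin_add_pi_div_two]; simp
  have hda := h.hasDerivAt (x := a) (by linarith) (by linarith)
  have hdb := h.hasDerivAt (x := b) (by linarith) (by linarith)
  rw [hca, hsa] at hda
  rw [hcb, hsb] at hdb
  have hle := (hconv.le_slope_of_hasDerivAt (mem_univ a) (mem_univ b) (by linarith) hda).trans
    (hconv.slope_le_of_hasDerivAt (mem_univ a) (mem_univ b) (by linarith) hdb)
  have ha0 : 0 < a - x₀ := by linarith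
  have hb0 : 0 < b - x₀ := by linarith
  have h1 : (r * (a - x₀)) ^ (p - 1) ≤ (b - x₀) ^ (p - 1) := by
    rw [Real.mul_rpow (by linarith) ha0.le, hrp, div_mul_eq_mul_div, div_le_iff₀ (by linarith)]
    linarith
  have h2 : r * (a - x₀) ≤ b - x₀ :=
    (Real.rpow_le_rpow_iff (by positivity) hb0.le (by linarith)).1 h1
  have h3 : Real.pi / (r - 1) * (r - 1) = Real.pi := div_mul_cancel₀ _ (by linarith)
  have h4 : (r - 1) * (a - x₀) ≤ Real.pi := by linarith
  have h5 : Real.pi / (r - 1) < a - x₀ := by linarith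
  have h6 := mul_lt_mul_of_pos_right h5 (sub_pos.2 hr1)
  linarith

end

/-! ### Normalisation and conclusion -/

/-- Normalising only shifts the potential by a constant, which leaves its derivative unchanged. -/
lemma gibbs_eq_expMeasure {V : ℝ → ℝ} (hZ : 0 < ∫ y, Real.exp (-V y)) :
    gibbs V = expMeasure fun x => V x + Real.log (∫ y, Real.exp (-V y)) := by
  unfold gibbs expMeasure
  congr 1
  funext x
  rw [neg_add, Real.exp_add, Real.exp_neg (Real.log _), Real.exp_log hZ, div_eq_mul_inv]

lemma isProbabilityMeasure_gibbs {V : ℝ → ℝ} (hV : Integrable fun x => Real.exp (-V x))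
    (hZ : 0 < ∫ y, Real.exp (-V y)) : IsProbabilityMeasure (gibbs V) := by
  refine ⟨?_⟩
  rw [gibbs, withDensity_apply _ MeasurableSet.univ, setLIntegral_univ,
    ← ofReal_integral_eq_lintegral_ofReal (hV.div_const _)
      (ae_of_all _ fun x => div_nonneg (Real.exp_pos _).le hZ.le),
    integral_div, div_self hZ.ne', ENNReal.ofReal_one]

end ModifiedLogSobolev

open ModifiedLogSobolev

theorem corollary1 (p q k x₀ : ℝ) (hq : 2 < q) (hp : q / (q - 1) ≤ p)
    (hk₀ : 0 < k) (hk₁ : k < 1)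
    (α V : ℝ → ℝ)
    (hα : ∀ x : ℝ, 1 < |x| → α x = k * dist x₀ x ^ (p - 1))
    (hα_bdd : ∃ M : ℝ, ∀ x : ℝ, |x| ≤ 1 → |α x| ≤ M)
    (hV : ∀ x : ℝ, V x = dist x₀ x ^ p + α x * Real.cos x)
    (hV_diff : ∀ᵐ x ∂(volume : Measure ℝ), DifferentiableAt ℝ V x) :
    IsProbabilityMeasure (ModifiedLogSobolev.gibbs V) ∧
      ¬ ConvexOn ℝ Set.univ V ∧
      ModifiedLogSobolev.SatisfiesMLS q (ModifiedLogSobolev.gibbs V) := by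
  have hp1 : 1 < p := lt_of_lt_of_le ((one_lt_div (by linarith)).2 (by linarith)) hp
  have hdist : ∀ x : ℝ, dist x₀ x = |x - x₀| := fun x => by rw [dist_comm, Real.dist_eq]
  have hcos : IsCosPerturbation p k x₀ V := fun x hx => by rw [hV, hα x hx, hdist]
  have hbdd : ∃ B, ∀ x, |x| ≤ 1 → |V x| ≤ B := by
    obtain ⟨M, hM⟩ := hα_bdd
    refine ⟨(1 + |x₀|) ^ p + M, fun x hx => ?_⟩
    rw [hV, hdist]
    refine (abs_add_le _ _).trans (add_le_add ?_ ?_)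
    · rw [abs_of_nonneg (by positivity)]
      exact Real.rpow_le_rpow (abs_nonneg _) ((abs_sub x x₀).trans (by linarith)) (by linarith)
    · rw [abs_mul]
      exact (mul_le_of_le_one_right (abs_nonneg _) (Real.abs_cos_le_one x)).trans (hM x hx)
  have hmeas := aemeasurable_of_ae_differentiableAt hV_diff
  have hint : Integrable fun x => Real.exp (-V x) := by
    obtain ⟨M, hM⟩ := hcos.exists_ge hp1.le hk₀.le hk₁.le hbdd
    refine ((integrable_exp_neg_mul_abs_sub (sub_pos.2 hk₁) x₀).const_mul (Real.exp M)).mono'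
      (by fun_prop) (ae_of_all _ fun x => ?_)
    rw [Real.norm_of_nonneg (Real.exp_pos _).le, ← Real.exp_add]
    exact Real.exp_le_exp.2 (by linarith [hM x])
  have hZ : 0 < ∫ y, Real.exp (-V y) := integral_exp_pos hint
  have hprob := isProbabilityMeasure_gibbs hint hZ
  refine ⟨hprob, hcos.not_convexOn hp1 hk₀ (hk₁.trans hp1), ?_⟩
  obtain ⟨M, hM0, hM⟩ := hcos.exists_le hp1.le hk₀.le hbdd (Real.log (∫ y, Real.exp (-V y)))
  rw [gibbs_eq_expMeasure hZ] at hprob ⊢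
  refine HasPowerGrowth.satisfiesMLS (x₀ := x₀) (R := 2 + |x₀|) (c := p * (1 - k)) (M := M)
    (p := p) ⟨by linarith [abs_nonneg x₀], mul_pos (by linarith) (sub_pos.2 hk₁), hM0, hp1.le,
      by fun_prop, hM, hcos.hasRightTail hp1.le hk₀.le _, ?_⟩ hq hp
  have := hcos.reflect.hasRightTail hp1.le hk₀.le (Real.log (∫ y, Real.exp (-V y)))
  rwa [abs_neg] at this
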